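/- Call a set, function or group definable if it is definable, with parameters, in the real field $(\mathbb R,+,\cdot)$. Let $\mathrm T=[0,1)$ with addition modulo $1$, let $\mathrm{SO}_2=\{a+b\mathbf i: a^2+b^2=1\}$ with complex multiplication, and let $\mathrm{SU}_2=\{a+b\mathbf i+c\mathbf j+d\mathbf k: a^2+b^2+c^2+d^2=1\}$ with quaternion multiplication. Let $\Gamma=\{(0,1),(\tfrac12,-1)\}$, a normal subgroup of $\mathrm T\times\mathrm{SU}_2$, and let $G=(\mathrm T\times\mathrm{SU}_2)/\Gamma$, with the quotient topology (where $\mathrm T$ carries the topology of $\mathbb R/\mathbb Z$ and $\mathrm{SU}_2$ that of $\mathbb R^4$). Then the following hold. 1. $G$ is a definable quotient: there are $n$ and an injection $c\colon G\to\mathbb R^n$ such that the composite $\mathrm T\times\mathrm{SU}_2\to G\to\mathbb R^n$ of the projection with $c$ is a definable function. 2. For every such $c$, identify $G$ with $c(G)\subseteq\mathbb R^n$. Then $G$ is a definable group; the quotient topology makes it a topological group and has a finite atlas of definable homeomorphisms from definable open subsets of $G$ onto open subsets of some $\mathbb R^d$; and $G$ is definably compact for this topology, i.e. every continuous definable curve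 $(a,b)\to G$ has limits in $G$ at both endpoints. 3. For every such $c$, the derived subgroup $G'$ of $G$ has no definable semidirect complement: there is no definable subgroup $H$ of $G$ such that every element of $G$ can be written uniquely as $g\cdot h$ with $g\in G'$ and $h\in H$. 4. In contrast, $G'$ does have a semidirect complement in $G$ that is a closed subgroup for the quotient topology. 5. Every definable group homomorphism $\mathrm T\to\mathrm{SO}_2$ is trivial. -/

import Mathlib

open Set Filter Topology

/-- `S ⊆ ℝ^ι` is definable, with parameters, in the real field `(ℝ, +, ·)`. -/
def RDefinable {ι : Type} (S : Set (ι → ℝ)) : Prop :=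
  letI := FirstOrder.Ring.compatibleRingOfRing ℝ
  (Set.univ : Set ℝ).Definable FirstOrder.Language.ring S

/-! In what follows a type `X` is placed in some `ℝ^ι`, `ι` finite, by an (injective) map
`c : X → ι → ℝ`, and definability is read off in these coordinates. -/

/-- The subset `S` of `X` is definable, in the coordinates `c`. -/
def DefinableSetIn {ι X : Type} (c : X → ι → ℝ) (S : Set X) : Prop :=
  RDefinable (c '' S)

/-- The restriction of `f : X → Y` to `S ⊆ X` is a definable function (its graph is definable),
in the coordinates `c` on `X` and `c'` on `Y`. No continuity is required. -/
def DefinableFunOn {ι κ X Y : Type} (c : X → ι → ℝ) (c' : Y → κ → ℝ) (f : X → Y)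
    (S : Set X) : Prop :=
  RDefinable {v : ι ⊕ κ → ℝ | ∃ x ∈ S, v = Sum.elim (c x) (c' (f x))}

/-- The coordinates `c` make the group `G` a definable group: they identify `G` with a definable
subset of `ℝ^n` on which the multiplication is definable. -/
structure IsDefinableGroup {n : ℕ} {G : Type} [Group G] (c : G → Fin n → ℝ) : Prop where
  injective : Function.Injective c
  definable_carrier : DefinableSetIn c Set.univ
  definable_mul : RDefinable {v : (Fin n ⊕ Fin n) ⊕ Fin n → ℝ |
    ∃ x y : G, v = Sum.elim (Sum.elim (c x) (c y)) (c (x * y))}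

/-- The topology of `G` is a definable manifold topology: there is a finite atlas of definable
homeomorphisms from definable open sets covering `G` onto open subsets of some `ℝ^d`. -/
def IsDefinableManifold {n : ℕ} {G : Type} [TopologicalSpace G] (c : G → Fin n → ℝ) : Prop :=
  ∃ (d m : ℕ) (φ : Fin m → OpenPartialHomeomorph G (Fin d → ℝ)),
    (∀ x, ∃ i, x ∈ (φ i).source) ∧
    ∀ i, DefinableSetIn c (φ i).source ∧ DefinableFunOn c id (φ i) (φ i).source

/-- Definable compactness: every continuous definable curve `(a, b) → G` has limits in `G`
at both endpoints. -/
def IsDefinablyCompact {n : ℕ} {G : Type} [TopologicalSpace G] (c : G → Fin n → ℝ) : Prop :=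
  ∀ (a b : ℝ) (γ : ℝ → G), a < b → ContinuousOn γ (Set.Ioo a b) →
    DefinableFunOn (fun (t : ℝ) (_ : Fin 1) => t) c γ (Set.Ioo a b) →
    (∃ x, Tendsto γ (𝓝[>] a) (𝓝 x)) ∧ (∃ y, Tendsto γ (𝓝[<] b) (𝓝 y))

/-- `G`, in the coordinates `c` and with its given topology, is a definably compact definable
group. The topology of a definable group is the (unique) definable manifold topology that makes
it a topological group, so the given topology is required to be that one. -/
structure IsDefinablyCompactGroup {n : ℕ} {G : Type} [Group G] [TopologicalSpace G]
    (c : G → Fin n → ℝ) : Prop where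
  definableGroup : IsDefinableGroup c
  topologicalGroup : IsTopologicalGroup G
  manifold : IsDefinableManifold c
  compact : IsDefinablyCompact c

/-- The group `T = [0,1)` with addition modulo `1`, that is `ℝ/ℤ` (written multiplicatively);
its definable structure is given by `Torus.coord`, the representative in `[0,1)`. -/
abbrev Torus : Type := Multiplicative (AddCircle (1 : ℝ))

/-- The representative in `[0,1)`, as a point of `ℝ^1`. -/
noncomputable def Torus.coord (t : Torus) : Fin 1 → ℝ :=
  fun _ => (AddCircle.equivIco (1 : ℝ) 0 (Multiplicative.toAdd t) : ℝ)

/-- The unit circle `SO₂ = {a + b i : a² + b² = 1}` in `ℝ²`, with the complex product. -/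
noncomputable def SO2.coord (z : Circle) : Fin 2 → ℝ := ![(z : ℂ).re, (z : ℂ).im]

/-- The group `SU₂` of quaternions `a + b i + c j + d k` with `a² + b² + c² + d² = 1`
(see `SU2.mem_iff`), with the quaternion product and the topology of `ℝ⁴`. -/
abbrev SU2 : Type := unitary (Quaternion ℝ)

theorem SU2.mem_iff (q : Quaternion ℝ) : q ∈ unitary (Quaternion ℝ) ↔
    q.re ^ 2 + q.imI ^ 2 + q.imJ ^ 2 + q.imK ^ 2 = 1 := by
  rw [Unitary.mem_iff, Quaternion.star_mul_self, Quaternion.self_mul_star, and_self,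
    ← Quaternion.normSq_def', ← Quaternion.coe_one, Quaternion.coe_inj]

/-- The coefficients `(a, b, c, d)`. -/
noncomputable def SU2.coord (q : SU2) : Fin 4 → ℝ :=
  ![(q : Quaternion ℝ).re, (q : Quaternion ℝ).imI, (q : Quaternion ℝ).imJ, (q : Quaternion ℝ).imK]

/-- The coordinates of `T × SU₂` in `ℝ^1 × ℝ^4`. -/
noncomputable def TorusSU2.coord (p : Torus × SU2) : Fin 1 ⊕ Fin 4 → ℝ :=
  Sum.elim (Torus.coord p.1) (SU2.coord p.2)

/-- The element `1/2` of `T`. -/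
noncomputable def Torus.half : Torus := Multiplicative.ofAdd (((1 / 2 : ℝ)) : AddCircle (1 : ℝ))

theorem Torus.half_mul_half : Torus.half * Torus.half = 1 := by
  rw [Torus.half, ← ofAdd_add, ← AddCircle.coe_add, ← ofAdd_zero]
  congr 1
  norm_num

/-- The subgroup `Γ = {(0, 1), (1/2, -1)}` of `T × SU₂`. -/
noncomputable def Gam : Subgroup (Torus × SU2) where
  carrier := {(1, 1), (Torus.half, -1)}
  one_mem' := Or.inl rfl
  mul_mem' := by
    rintro _ _ (rfl | rfl) (rfl | rfl) <;> simp [Prod.ext_iff, Torus.half_mul_half]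
  inv_mem' := by
    rintro _ (rfl | rfl)
    · simp
    · right
      have h : (-1 : SU2)⁻¹ = -1 := inv_eq_of_mul_eq_one_left (by simp)
      simp [h, inv_eq_of_mul_eq_one_left Torus.half_mul_half]

instance Gam.normal : Gam.Normal where
  conj_mem := by
    rintro _ (rfl | rfl) g
    · left; simp [Prod.ext_iff]
    · right; simp [Prod.ext_iff]

/-- The group `G = (T × SU₂) / Γ`, with the quotient topology. -/
abbrev GEx : Type := (Torus × SU2) ⧸ Gam

/-- Coordinates `c` on `G` presenting it as the quotient of `T × SU₂` by `Γ` in the definable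
category: `c` identifies `G` with a subset of `ℝ^n` so that the projection `T × SU₂ → G` is
definable. -/
def IsDefinableQuotient {n : ℕ} (c : GEx → Fin n → ℝ) : Prop :=
  Function.Injective c ∧
    DefinableFunOn TorusSU2.coord c (QuotientGroup.mk : Torus × SU2 → GEx) Set.univ

/-! A complement H of G' is forced to be a graph. Every unit quaternion is a commutator
(`SU2.exists_commutator`) and T is abelian, so G' is the image of SU₂. Hence the preimage of H in T
× SU₂ is the graph of a homomorphism f : T → SU₂, and f(1/2) = -1 because that preimage contains Γ
(`GEx.exists_hom_of_isComplement'`). The map t ↦ exp(2πit) is such a homomorphism, and its graph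
gives the closed complement. If H is definable, so is f. Then u = f(1/4) has square -1 and commutes
with the image of f, which therefore lies in the circle of elements a + bu; this turns f into a
definable homomorphism T → SO₂ sending 1/2 to -1 (`Torus.hom_SU2_half_ne`).

No such homomorphism exists (`Torus.hom_eq_one_of_definable`). Pulled back to ℝ, a definable
homomorphism T → SO₂ cannot oscillate at 0, so it has a right limit there; additivity makes the
limit 1 and the map continuous, hence equal to exp(ikt). If k ≠ 0, the graph of cos(kt) on (0,1)
would be definable, hence contained in the zero set of a nonzero polynomial in two variables, which
is impossible.

Both consequences of definability, absence of oscillation and algebraicity of graphs, come from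
quantifier elimination (`RDefinable.semialgebraic`). It is proved by Hörmander's method: the sign
diagram of a polynomial P together with a finite family is determined by the diagram of the family,
P', and the remainders of P modulo these (`SignEquiv.insert_of_derivative`); induction on the degree
reduces to constants.

The remaining claims are transferred from T × SU₂ along the projection. Definable compactness
combines the absence of oscillation with ordinary compactness of G, and the atlas consists of
finitely many translates of one chart. -/

section

open Polynomial SignType

/-! ### Sign diagrams of polynomials in one variable and Hörmander's step -/

/-- Data matching the cells of two real polynomials. -/
structure CellMatch (P Q : ℝ[X]) (S T : Set ℝ) (M N : ℝ → ℤ) : Prop where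
  mono_left : Monotone M
  mono_right : Monotone N
  range_eq : range M = range N
  finite_left : S.Finite
  finite_right : T.Finite
  mem_iff : ∀ y z, M y = N z → (y ∈ S ↔ z ∈ T)
  inj_left : ∀ y y', y ∈ S → M y = M y' → y = y'
  inj_right : ∀ z z', z ∈ T → N z = N z' → z = z'
  sign_eq : ∀ y z, M y = N z → y ∈ S → sign (P.eval y) = sign (Q.eval z)
  sign_deriv : ∀ y z, M y = N z → sign (P.derivative.eval y) = sign (Q.derivative.eval z)
  deriv_left : ∀ y, P.derivative.eval y = 0 → y ∈ S
  deriv_right : ∀ z, Q.derivative.eval z = 0 → z ∈ T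


theorem CellMatch.symm {P Q : ℝ[X]} {S T : Set ℝ} {M N : ℝ → ℤ} (h : CellMatch P Q S T M N) :
    CellMatch Q P T S N M where
  mono_left := h.mono_right
  mono_right := h.mono_left
  range_eq := h.range_eq.symm
  finite_left := h.finite_right
  finite_right := h.finite_left
  mem_iff y z e := (h.mem_iff z y e.symm).symm
  inj_left := h.inj_right
  inj_right := h.inj_left
  sign_eq y z e hy := (h.sign_eq z y e.symm ((h.mem_iff z y e.symm).2 hy)).symm
  sign_deriv y z e := (h.sign_deriv z y e.symm).symm
  deriv_left := h.deriv_right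
  deriv_right := h.deriv_left

/-- Reflection in the origin exchanges the two ends of a cell, so that `CellMatch.lower` becomes a
case of `CellMatch.upper`. -/
theorem CellMatch.neg {P Q : ℝ[X]} {S T : Set ℝ} {M N : ℝ → ℤ} (h : CellMatch P Q S T M N) :
    CellMatch (P.comp (-X)) (Q.comp (-X)) (-S) (-T) (fun y => -M (-y)) (fun z => -N (-z)) where
  mono_left a b hab := neg_le_neg (h.mono_left (neg_le_neg hab))
  mono_right a b hab := neg_le_neg (h.mono_right (neg_le_neg hab))
  range_eq := by
    have key : ∀ K : ℝ → ℤ, range (fun y => -K (-y)) = (fun n => -n) '' range K := by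
      intro K
      ext n
      constructor
      · rintro ⟨y, rfl⟩
        exact ⟨_, ⟨-y, rfl⟩, rfl⟩
      · rintro ⟨_, ⟨y, rfl⟩, rfl⟩
        exact ⟨-y, by simp⟩
    rw [key, key, h.range_eq]
  finite_left := h.finite_left.neg
  finite_right := h.finite_right.neg
  mem_iff y z e := h.mem_iff (-y) (-z) (neg_injective e)
  inj_left y y' hy e := neg_injective (h.inj_left (-y) (-y') hy (neg_injective e))
  inj_right y y' hy e := neg_injective (h.inj_right (-y) (-y') hy (neg_injective e))
  sign_eq y z e hy := by
    simpa using h.sign_eq (-y) (-z) (neg_injective e) hy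
  sign_deriv y z e := by
    have := h.sign_deriv (-y) (-z) (neg_injective e)
    simp [derivative_comp, Left.sign_neg, this]
  deriv_left y hy := h.deriv_left (-y) (by simpa [derivative_comp] using hy)
  deriv_right y hy := h.deriv_right (-y) (by simpa [derivative_comp] using hy)

theorem Polynomial.sign_eval_eq_of_forall_ne_zero (p : ℝ[X]) (a b : ℝ)
    (h : ∀ w ∈ uIcc a b, p.eval w ≠ 0) : sign (p.eval a) = sign (p.eval b) := by
  by_contra hne
  have hc : ContinuousOn (fun x => p.eval x) (uIcc a b) := p.continuous.continuousOn
  have h0 : (0 : ℝ) ∈ uIcc (p.eval a) (p.eval b) := by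
    rw [mem_uIcc]
    have ha := h a left_mem_uIcc
    have hb := h b right_mem_uIcc
    rcases lt_or_gt_of_ne ha with ha | ha <;> rcases lt_or_gt_of_ne hb with hb | hb
    · exact absurd (by rw [sign_neg ha, sign_neg hb]) hne
    · exact Or.inl ⟨ha.le, hb.le⟩
    · exact Or.inr ⟨hb.le, ha.le⟩
    · exact absurd (by rw [sign_pos ha, sign_pos hb]) hne
  obtain ⟨w, hw, hw0⟩ := intermediate_value_uIcc hc h0
  exact h w hw hw0

/-- A point of `S` shares its label with no other point, so the strict order of the points is strict
on labels, and monotonicity of `N` reflects it. -/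
theorem CellMatch.lt_of_mem {P Q : ℝ[X]} {S T : Set ℝ} {M N : ℝ → ℤ} (h : CellMatch P Q S T M N)
    {y y' z z' : ℝ} (e : M y = N z) (e' : M y' = N z') (hy : y ∈ S ∨ y' ∈ S) (hyy : y < y') :
    z < z' := by
  have h1 : M y < M y' := by
    refine lt_of_le_of_ne (h.mono_left hyy.le) fun e0 => hyy.ne ?_
    rcases hy with hy | hy
    · exact h.inj_left _ _ hy e0
    · exact (h.inj_left _ _ hy e0.symm).symm
  by_contra hz
  have := h.mono_right (not_lt.1 hz)
  omega

/-- A nonconstant polynomial is unbounded in absolute value, and an increasing one is bounded below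
on the half-line, so it must tend to +∞. -/
theorem Polynomial.exists_pos_of_derivative_pos (R : ℝ[X]) (z : ℝ)
    (h : ∀ x, z ≤ x → 0 < R.derivative.eval x) : ∃ x, z ≤ x ∧ 0 < R.eval x := by
  have hmono : StrictMonoOn (fun x => R.eval x) (Ici z) := by
    refine strictMonoOn_of_deriv_pos (convex_Ici z) R.continuous.continuousOn fun x hx => ?_
    rw [interior_Ici] at hx
    rw [Polynomial.deriv]
    exact h x (le_of_lt hx)
  have hdeg : 0 < R.degree := by
    rw [← natDegree_pos_iff_degree_pos]
    by_contra h0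
    obtain ⟨c, rfl⟩ := natDegree_eq_zero.1 (Nat.eq_zero_of_not_pos h0)
    simpa using h z le_rfl
  have ht := Polynomial.abs_tendsto_atTop R hdeg
  obtain ⟨x, hx1, hx2⟩ := ((ht.eventually_gt_atTop |R.eval z|).and (eventually_ge_atTop z)).exists
  refine ⟨x, hx2, ?_⟩
  by_contra hneg
  have h1 : R.eval z ≤ R.eval x := hmono.monotoneOn self_mem_Ici hx2 hx2
  rw [abs_of_nonpos (not_lt.1 hneg), abs_of_nonpos (h1.trans (not_lt.1 hneg))] at hx1
  linarith

/-- `P'` keeps the sign it has at `y`. Multiplying by the constant `P'(y)` treats increasing and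
decreasing `P` at once; this is also why signs of `P' * P`, not of `P`, are used below. -/
theorem Polynomial.strictMonoOn_mul_of_forall_ne (P : ℝ[X]) {y v : ℝ}
    (h : ∀ w ∈ Ico y v, P.derivative.eval w ≠ 0) :
    StrictMonoOn (fun x => P.derivative.eval y * P.eval x) (Icc y v) := by
  refine strictMonoOn_of_deriv_pos (convex_Icc y v) (by fun_prop) fun x hx => ?_
  rw [interior_Icc] at hx
  rw [deriv_const_mul _ P.differentiableAt, Polynomial.deriv]
  have hs := P.derivative.sign_eval_eq_of_forall_ne_zero y x fun w hw => by
    rw [uIcc_of_le hx.1.le] at hw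
    exact h w ⟨hw.1, hw.2.trans_lt hx.2⟩
  have h0 := h y ⟨le_rfl, hx.1.trans hx.2⟩
  rw [← sign_eq_one_iff, sign_mul, ← hs]
  rcases lt_or_gt_of_ne h0 with h0 | h0 <;> simp [sign_neg, sign_pos, h0]

theorem mul_pos_of_sign_eq {a b c d : ℝ} (h1 : sign a = sign c) (h2 : sign b = sign d)
    (h : 0 < a * b) : 0 < c * d := by
  rw [← sign_eq_one_iff, sign_mul] at h ⊢
  rwa [← h1, ← h2]

/-- The oriented polynomial increases along the gap of `S` containing `y`, so it is still positive
at the right end of the gap. If that end is a point of `S`, the matching point of `T` carries the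
same sign, and continuity moves it into the gap of `z`. If the gap is unbounded, positivity far out
is automatic. -/
theorem CellMatch.upper {P Q : ℝ[X]} {S T : Set ℝ} {M N : ℝ → ℤ} (h : CellMatch P Q S T M N)
    {y z : ℝ} (e : M y = N z) (hy : y ∉ S) (hpos : 0 < P.derivative.eval y * P.eval y) :
    ∃ z', z ≤ z' ∧ (∀ w ∈ Icc z z', w ∉ T) ∧ 0 < Q.derivative.eval z * Q.eval z' := by
  have hz : z ∉ T := fun hz => hy ((h.mem_iff y z e).2 hz)
  by_cases hS : (S ∩ Ioi y).Nonempty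
  -- `v` is the first point of `S` to the right of `y`.
  · obtain ⟨v, ⟨hvS, hyv⟩, hmin⟩ := Set.exists_min_image _ id (h.finite_left.inter_of_left _) hS
    obtain ⟨w, hw⟩ : M v ∈ range N := h.range_eq ▸ mem_range_self v
    have hwT : w ∈ T := (h.mem_iff v w hw.symm).1 hvS
    have hzw : z < w := h.lt_of_mem e hw.symm (Or.inr hvS) hyv
    have hPv : 0 < P.derivative.eval y * P.eval v := by
      refine hpos.trans (P.strictMonoOn_mul_of_forall_ne (y := y) (v := v) ?_
        (left_mem_Icc.2 (le_of_lt hyv)) (right_mem_Icc.2 (le_of_lt hyv)) hyv)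
      intro u hu h0
      rcases hu.1.eq_or_lt with rfl | hlt
      · exact hy (h.deriv_left _ h0)
      · exact absurd (hmin u ⟨h.deriv_left _ h0, hlt⟩) (not_le.2 hu.2)
    have hQw : 0 < Q.derivative.eval z * Q.eval w :=
      mul_pos_of_sign_eq (h.sign_deriv y z e) (h.sign_eq v w hw.symm hvS) hPv
    have hev : ∀ᶠ x in 𝓝[<] w, 0 < Q.derivative.eval z * Q.eval x := by
      have hc : ContinuousAt (fun x => Q.derivative.eval z * Q.eval x) w := by fun_prop
      exact (hc.eventually (lt_mem_nhds hQw)).filter_mono nhdsWithin_le_nhds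
    obtain ⟨z', hz', hzz'⟩ := (hev.and (Ioo_mem_nhdsLT hzw)).exists
    refine ⟨z', hzz'.1.le, fun u hu huT => ?_, hz'⟩
    have hzu : z < u := lt_of_le_of_ne hu.1 fun e => hz (e ▸ huT)
    obtain ⟨x, hx⟩ : N u ∈ range M := h.range_eq ▸ mem_range_self u
    have hxS : x ∈ S := (h.mem_iff x u hx).2 huT
    have hyx : y < x := h.symm.lt_of_mem e.symm hx.symm (Or.inr huT) hzu
    have hxv : x < v := h.symm.lt_of_mem hx.symm hw (Or.inl huT) (hu.2.trans_lt hzz'.2)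
    exact absurd (hmin x ⟨hxS, hyx⟩) (not_le.2 hxv)
  · have hT : ∀ u, z ≤ u → u ∉ T := by
      intro u hu huT
      have hzu : z < u := lt_of_le_of_ne hu fun e => hz (e ▸ huT)
      obtain ⟨x, hx⟩ : N u ∈ range M := h.range_eq ▸ mem_range_self u
      exact hS ⟨x, (h.mem_iff x u hx).2 huT, h.symm.lt_of_mem e.symm hx.symm (Or.inr huT) hzu⟩
    obtain ⟨x, hx1, hx2⟩ := (C (Q.derivative.eval z) * Q).exists_pos_of_derivative_pos z (by
      intro x hx
      have hs := Q.derivative.sign_eval_eq_of_forall_ne_zero z x fun w hw h0 => by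
        rw [uIcc_of_le hx] at hw
        exact hT w hw.1 (h.deriv_right _ h0)
      have h0 : Q.derivative.eval z ≠ 0 := fun h0 => hz (h.deriv_right _ h0)
      simp only [derivative_mul, derivative_C, zero_mul, zero_add, eval_mul, eval_C]
      rw [← sign_eq_one_iff, sign_mul, ← hs]
      rcases lt_or_gt_of_ne h0 with h0 | h0 <;> simp [sign_neg, sign_pos, h0])
    exact ⟨x, hx1, fun w hw => hT w hw.1, by simpa using hx2⟩

theorem CellMatch.lower {P Q : ℝ[X]} {S T : Set ℝ} {M N : ℝ → ℤ} (h : CellMatch P Q S T M N)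
    {y z : ℝ} (e : M y = N z) (hy : y ∉ S) (hneg : P.derivative.eval y * P.eval y < 0) :
    ∃ z', z' ≤ z ∧ (∀ w ∈ Icc z' z, w ∉ T) ∧ Q.derivative.eval z * Q.eval z' < 0 := by
  obtain ⟨x, h1, h2, h3⟩ := h.neg.upper (y := -y) (z := -z) (by simpa using e) (by simpa using hy)
    (by simpa [derivative_comp] using hneg)
  refine ⟨-x, by linarith, fun w hw hwT => h2 (-w) ⟨by linarith [hw.2], by linarith [hw.1]⟩
    (by simpa using hwT), by simpa [derivative_comp] using h3⟩

/-- Used to forget the distinctions that old labels make inside a gap of `S`, while keeping the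
points of `S` apart from the gaps on both sides. -/
theorem exists_monotone_separating (A : Set ℤ) (hA : A.Finite) :
    ∃ κ : ℤ → ℤ, Monotone κ ∧ ∀ a b, a < b → (κ a = κ b ↔ ∀ c ∈ A, ¬ (a ≤ c ∧ c ≤ b)) := by
  classical
  -- `f c` is 0 before `c`, 1 at `c` and 2 after `c`: one jump on reaching `c` and one on leaving
  -- it.
  let f : ℤ → ℤ → ℤ := fun c l => (if c < l then 1 else 0) + (if c ≤ l then 1 else 0)
  have hf : ∀ c, Monotone (f c) := by
    intro c a b hab
    simp only [f]
    split_ifs <;> omega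
  refine ⟨fun l => ∑ c ∈ hA.toFinset, f c l,
    fun a b hab => Finset.sum_le_sum fun c _ => hf c hab, fun a b hab => ?_⟩
  constructor
  · intro h c hc hcc
    refine (Finset.sum_lt_sum (fun c _ => hf c hab.le) ⟨c, by simpa using hc, ?_⟩).ne h
    simp only [f]
    split_ifs <;> omega
  · intro h
    refine Finset.sum_congr rfl fun c hc => ?_
    have := h c (by simpa using hc)
    simp only [f]
    split_ifs <;> omega

theorem CellMatch.cell_iff {P Q : ℝ[X]} {S T : Set ℝ} {M N : ℝ → ℤ} (h : CellMatch P Q S T M N)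
    {κ : ℤ → ℤ} (hκ : ∀ a b, a < b → (κ a = κ b ↔ ∀ c ∈ M '' S, ¬ (a ≤ c ∧ c ≤ b)))
    (y y' : ℝ) : κ (M y) = κ (M y') ↔ y = y' ∨ ∀ w ∈ uIcc y y', w ∉ S := by
  wlog hyy : y < y' generalizing y y'
  · rcases (not_lt.1 hyy).eq_or_lt with rfl | hlt
    · simp
    · rw [eq_comm, this y' y hlt, eq_comm, uIcc_comm]
  rw [uIcc_of_le hyy.le]
  constructor
  · intro e
    right
    intro w hw hwS
    rcases (h.mono_left hyy.le).eq_or_lt with e0 | hlt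
    · have h1 := h.mono_left hw.1
      have h2 := h.mono_left hw.2
      have e1 := h.inj_left w y hwS (by omega)
      have e2 := h.inj_left w y' hwS (by omega)
      exact hyy.ne (e1.symm.trans e2)
    · exact (hκ _ _ hlt).1 e _ ⟨w, hwS, rfl⟩ ⟨h.mono_left hw.1, h.mono_left hw.2⟩
  · rintro (rfl | hno)
    · rfl
    · rcases (h.mono_left hyy.le).eq_or_lt with e0 | hlt
      · rw [e0]
      · rw [hκ _ _ hlt]
        rintro _ ⟨w, hw, rfl⟩ ⟨h1, h2⟩
        refine hno w ⟨?_, ?_⟩ hw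
        · by_contra hlt'
          have := h.mono_left (not_le.1 hlt').le
          exact hlt' (h.inj_left w y hw (by omega)).ge
        · by_contra hlt'
          have := h.mono_left (not_le.1 hlt').le
          exact hlt' (h.inj_left w y' hw (by omega)).le

theorem CellMatch.image_eq {P Q : ℝ[X]} {S T : Set ℝ} {M N : ℝ → ℤ} (h : CellMatch P Q S T M N) :
    M '' S = N '' T := by
  have key : ∀ {P Q : ℝ[X]} {S T : Set ℝ} {M N : ℝ → ℤ}, CellMatch P Q S T M N →
      M '' S ⊆ N '' T := by
    rintro P Q S T M N h _ ⟨y, hy, rfl⟩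
    obtain ⟨z, hz⟩ : M y ∈ range N := h.range_eq ▸ mem_range_self y
    exact ⟨z, (h.mem_iff y z hz.symm).1 hy, hz⟩
  exact (key h).antisymm (key h.symm)

/-- The cell number refined by the sign of `P`, oriented by the sign of the derivative. -/
noncomputable def refinedCell (κ : ℤ → ℤ) (P : ℝ[X]) (M : ℝ → ℤ) (y : ℝ) : ℤ :=
  3 * κ (M y) + (sign (P.derivative.eval y * P.eval y) : ℤ)

theorem SignType.cast_int_bounds (s : SignType) : (-1 : ℤ) ≤ (s : ℤ) ∧ (s : ℤ) ≤ 1 := by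
  cases s <;> simp

theorem SignType.cast_int_injective {s t : SignType} (h : (s : ℤ) = (t : ℤ)) : s = t := by
  cases s <;> cases t <;> simp_all

/-- The sign takes values in {-1, 0, 1}, so the factor 3 leaves both the cell and the sign
recoverable. -/
theorem refinedCell_eq_iff {κ : ℤ → ℤ} {P Q : ℝ[X]} {M N : ℝ → ℤ} {y z : ℝ} :
    refinedCell κ P M y = refinedCell κ Q N z ↔ κ (M y) = κ (N z) ∧
      sign (P.derivative.eval y * P.eval y) = sign (Q.derivative.eval z * Q.eval z) := by
  have h1 := SignType.cast_int_bounds (sign (P.derivative.eval y * P.eval y))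
  have h2 := SignType.cast_int_bounds (sign (Q.derivative.eval z * Q.eval z))
  unfold refinedCell
  constructor
  · intro e
    exact ⟨by omega, SignType.cast_int_injective (by omega)⟩
  · rintro ⟨e1, e2⟩
    rw [e1, e2]

/-- Within one gap the oriented polynomial is increasing, so its sign can only go up; between
different cells the first summand dominates. -/
theorem CellMatch.monotone_refinedCell {P Q : ℝ[X]} {S T : Set ℝ} {M N : ℝ → ℤ}
    (h : CellMatch P Q S T M N) {κ : ℤ → ℤ} (hm : Monotone κ)
    (hκ : ∀ a b, a < b → (κ a = κ b ↔ ∀ c ∈ M '' S, ¬ (a ≤ c ∧ c ≤ b))) :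
    Monotone (refinedCell κ P M) := by
  intro y y' hyy
  rcases hyy.eq_or_lt with rfl | hlt
  · rfl
  have h1 := SignType.cast_int_bounds (sign (P.derivative.eval y * P.eval y))
  have h2 := SignType.cast_int_bounds (sign (P.derivative.eval y' * P.eval y'))
  unfold refinedCell
  rcases (hm (h.mono_left hyy)).eq_or_lt with e | hlt'
  · have hno := ((h.cell_iff hκ y y').1 e).resolve_left hlt.ne
    rw [uIcc_of_le hyy] at hno
    have hs : sign (P.derivative.eval y) = sign (P.derivative.eval y') :=
      P.derivative.sign_eval_eq_of_forall_ne_zero y y' fun w hw h0 => by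
        rw [uIcc_of_le hyy] at hw
        exact hno w hw (h.deriv_left w h0)
    have hle : P.derivative.eval y * P.eval y < P.derivative.eval y * P.eval y' :=
      P.strictMonoOn_mul_of_forall_ne (fun w hw h0 =>
        hno w ⟨hw.1, hw.2.le⟩ (h.deriv_left w h0)) (left_mem_Icc.2 hyy) (right_mem_Icc.2 hyy) hlt
    rw [e, sign_mul (P.derivative.eval y'), ← hs, ← sign_mul]
    have := sign.monotone hle.le
    have h3 : ∀ s t : SignType, s ≤ t → (s : ℤ) ≤ (t : ℤ) := by decide
    have := h3 _ _ this
    omega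
  · omega

theorem CellMatch.sign_deriv_of_cell {P Q : ℝ[X]} {S T : Set ℝ} {M N : ℝ → ℤ}
    (h : CellMatch P Q S T M N) {κ : ℤ → ℤ}
    (hκ : ∀ a b, a < b → (κ a = κ b ↔ ∀ c ∈ M '' S, ¬ (a ≤ c ∧ c ≤ b)))
    {y y' : ℝ} (e : κ (M y) = κ (M y')) :
    sign (P.derivative.eval y) = sign (P.derivative.eval y') := by
  rcases (h.cell_iff hκ y y').1 e with rfl | hno
  · rfl
  · exact P.derivative.sign_eval_eq_of_forall_ne_zero y y' fun w hw h0 =>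
      hno w hw (h.deriv_left w h0)

/-- At a point of `S` the old matching already fixes the sign. In a gap, positive and negative
values transfer by `upper` and `lower`; a zero transfers because both signs then occur in the gap.
-/
theorem CellMatch.exists_refinedCell_eq {P Q : ℝ[X]} {S T : Set ℝ} {M N : ℝ → ℤ}
    (h : CellMatch P Q S T M N) {κ : ℤ → ℤ} (hm : Monotone κ)
    (hκ : ∀ a b, a < b → (κ a = κ b ↔ ∀ c ∈ M '' S, ¬ (a ≤ c ∧ c ≤ b))) (y : ℝ) :
    ∃ z, refinedCell κ Q N z = refinedCell κ P M y := by
  have hκ' := hκ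
  rw [h.image_eq] at hκ'
  simp only [refinedCell_eq_iff]
  by_cases hy : y ∈ S
  · obtain ⟨z, hz⟩ : M y ∈ range N := h.range_eq ▸ mem_range_self y
    refine ⟨z, by rw [hz], ?_⟩
    rw [sign_mul, sign_mul, h.sign_eq y z hz.symm hy, h.sign_deriv y z hz.symm]
  have hup : ∀ y, y ∉ S → 0 < P.derivative.eval y * P.eval y →
      ∃ z, κ (N z) = κ (M y) ∧ 0 < Q.derivative.eval z * Q.eval z := by
    intro y hy hpos
    obtain ⟨z, hz⟩ : M y ∈ range N := h.range_eq ▸ mem_range_self y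
    obtain ⟨z', h1, h2, h3⟩ := h.upper hz.symm hy hpos
    have e : κ (N z) = κ (N z') := (h.symm.cell_iff hκ' z z').2 (Or.inr (by rwa [uIcc_of_le h1]))
    exact ⟨z', by rw [← e, hz], mul_pos_of_sign_eq (h.symm.sign_deriv_of_cell hκ' e) rfl h3⟩
  have hlow : ∀ y, y ∉ S → P.derivative.eval y * P.eval y < 0 →
      ∃ z, κ (N z) = κ (M y) ∧ Q.derivative.eval z * Q.eval z < 0 := by
    intro y hy hneg
    obtain ⟨z, hz⟩ : M y ∈ range N := h.range_eq ▸ mem_range_self y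
    obtain ⟨z', h1, h2, h3⟩ := h.lower hz.symm hy hneg
    have e : κ (N z) = κ (N z') := (h.symm.cell_iff hκ' z z').2
      (Or.inr (by rwa [uIcc_comm, uIcc_of_le h1]))
    refine ⟨z', by rw [← e, hz], ?_⟩
    have := mul_pos_of_sign_eq (b := -Q.eval z') (h.symm.sign_deriv_of_cell hκ' e) rfl
      (by linarith)
    linarith
  rcases lt_trichotomy (P.derivative.eval y * P.eval y) 0 with hneg | hzero | hpos
  · obtain ⟨z, h1, h2⟩ := hlow y hy hneg
    exact ⟨z, h1, by rw [sign_neg h2, sign_neg hneg]⟩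
  -- `P` vanishes at `y` while `P'` does not, so the oriented polynomial is positive just to the
  -- right and negative just to the left, still inside the gap. Transferring these two points
  -- brackets a zero of `Q`.
  · have hP0 : P.eval y = 0 := (mul_eq_zero.1 hzero).resolve_left fun h0 => hy (h.deriv_left _ h0)
    obtain ⟨ε, hε, hball⟩ := Metric.isOpen_iff.1 h.finite_left.isClosed.isOpen_compl y hy
    have hno : ∀ w, |w - y| < ε → w ∉ S := fun w hw => hball (by simpa [Real.dist_eq] using hw)
    have hcell : ∀ w, |w - y| < ε → κ (M w) = κ (M y) := by
      intro w hw
      refine (h.cell_iff hκ w y).2 (Or.inr fun u hu => hno u ?_)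
      have := abs_sub_left_of_mem_uIcc (uIcc_comm w y ▸ hu)
      exact this.trans_lt hw
    have habs : |y + ε / 2 - y| < ε := by rw [add_sub_cancel_left, abs_of_pos] <;> linarith
    have habs' : |y - ε / 2 - y| < ε := by
      rw [sub_sub_cancel_left, abs_neg, abs_of_pos] <;> linarith
    have hne : ∀ a b, |a - y| < ε → |b - y| < ε → ∀ w ∈ Ico a b, P.derivative.eval w ≠ 0 := by
      intro a b ha hb w hw h0
      rw [abs_lt] at ha hb
      exact hno w (abs_lt.2 ⟨by linarith [hw.1], by linarith [hw.2]⟩) (h.deriv_left _ h0)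
    have hyy : |y - y| < ε := by simpa using hε
    obtain ⟨z1, e1, hz1⟩ := hup (y + ε / 2) (hno _ habs) (by
      have := P.strictMonoOn_mul_of_forall_ne (hne y (y + ε / 2) hyy habs)
        (left_mem_Icc.2 (by linarith)) (right_mem_Icc.2 (by linarith)) (by linarith)
      simp only [hP0, mul_zero] at this
      exact mul_pos_of_sign_eq (h.sign_deriv_of_cell hκ (hcell _ habs).symm) rfl this)
    obtain ⟨z2, e2, hz2⟩ := hlow (y - ε / 2) (hno _ habs') (by
      have := P.strictMonoOn_mul_of_forall_ne (hne (y - ε / 2) y habs' hyy)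
        (left_mem_Icc.2 (by linarith)) (right_mem_Icc.2 (by linarith)) (by linarith)
      simpa only [hP0, mul_zero] using this)
    rw [hcell _ habs] at e1
    rw [hcell _ habs'] at e2
    have e12 : κ (N z1) = κ (N z2) := e1.trans e2.symm
    have hsign := h.symm.sign_deriv_of_cell hκ' e12
    -- `Q'` has one sign on the gap, so `Q` has opposite signs at `z1` and `z2`.
    have hopp : ∃ w ∈ uIcc z1 z2, Q.eval w = 0 := by
      by_contra hcon
      push Not at hcon
      have h4 := Q.sign_eval_eq_of_forall_ne_zero z1 z2 hcon
      have := mul_pos_of_sign_eq hsign h4 hz1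
      linarith
    obtain ⟨w, hw, hw0⟩ := hopp
    have hmono : Monotone fun z => κ (N z) := hm.comp h.mono_right
    refine ⟨w, ?_, by rw [hw0, hP0, mul_zero, mul_zero]⟩
    have h5 := hmono.image_uIcc_subset ⟨w, hw, rfl⟩
    simp only [e1, e2, uIcc_self] at h5
    exact h5
  · obtain ⟨z, h1, h2⟩ := hup y hy hpos
    exact ⟨z, h1, by rw [sign_pos h2, sign_pos hpos]⟩

/-- The point `y₀` ties the new labels to the old ones: it lies in the same cell of `S` as `y`, so
polynomials without zeros off `S` keep their matched signs. -/
theorem CellMatch.exists_refinement {P Q : ℝ[X]} {S T : Set ℝ} {M N : ℝ → ℤ}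
    (h : CellMatch P Q S T M N) : ∃ M' N' : ℝ → ℤ, Monotone M' ∧ Monotone N' ∧
      range M' = range N' ∧ ∀ y z, M' y = N' z → sign (P.eval y) = sign (Q.eval z) ∧
        ∃ y₀, M y₀ = N z ∧ (y₀ = y ∨ ∀ w ∈ uIcc y₀ y, w ∉ S) := by
  obtain ⟨κ, hm, hκ⟩ := exists_monotone_separating (M '' S) (h.finite_left.image M)
  have hκ' := hκ
  rw [h.image_eq] at hκ'
  refine ⟨refinedCell κ P M, refinedCell κ Q N, h.monotone_refinedCell hm hκ,
    h.symm.monotone_refinedCell hm hκ', ?_, ?_⟩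
  · refine Subset.antisymm ?_ ?_
    · rintro _ ⟨y, rfl⟩
      exact h.exists_refinedCell_eq hm hκ y
    · rintro _ ⟨y, rfl⟩
      exact h.symm.exists_refinedCell_eq hm hκ' y
  · intro y z e
    rw [refinedCell_eq_iff] at e
    obtain ⟨y₀, hy₀⟩ : N z ∈ range M := h.range_eq ▸ mem_range_self z
    have hcell := e.1
    rw [← hy₀] at hcell
    have hc := (h.cell_iff hκ y₀ y).1 hcell.symm
    refine ⟨?_, y₀, hy₀, hc⟩
    by_cases hy : y ∈ S
    · rcases hc with rfl | hc
      · exact h.sign_eq _ _ hy₀ hy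
      · exact absurd hy (hc y right_mem_uIcc)
    · have hs := (h.sign_deriv_of_cell hκ hcell).trans (h.sign_deriv y₀ z hy₀)
      have h0 : P.derivative.eval y ≠ 0 := fun h0 => hy (h.deriv_left _ h0)
      -- The refined labels compare `P' * P` with `Q' * Q`; the equal nonzero signs of the
      -- derivatives cancel.
      have e2 := e.2
      rw [sign_mul, sign_mul, ← hs] at e2
      rcases lt_or_gt_of_ne h0 with h0 | h0 <;> simpa [sign_neg, sign_pos, h0] using e2

/-- Two families of real polynomials have the same sign diagram. -/
def SignEquiv {ι : Type*} (p q : ι → ℝ[X]) : Prop :=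
  ∃ M N : ℝ → ℤ, Monotone M ∧ Monotone N ∧ range M = range N ∧
    ∀ y z, M y = N z → ∀ i, sign ((p i).eval y) = sign ((q i).eval z)

theorem SignEquiv.comp {ι κ : Type*} {p q : ι → ℝ[X]} (h : SignEquiv p q) (f : κ → ι) :
    SignEquiv (p ∘ f) (q ∘ f) := by
  obtain ⟨M, N, h1, h2, h3, h4⟩ := h
  exact ⟨M, N, h1, h2, h3, fun y z e i => h4 y z e (f i)⟩

theorem SignEquiv.exists_sign_eq {ι : Type*} {p q : ι → ℝ[X]} (h : SignEquiv p q) (y : ℝ) :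
    ∃ z, ∀ i, sign ((p i).eval y) = sign ((q i).eval z) := by
  obtain ⟨M, N, h1, h2, h3, h4⟩ := h
  obtain ⟨z, hz⟩ : M y ∈ range N := h3 ▸ mem_range_self y
  exact ⟨z, h4 y z hz.symm⟩

theorem Monotone.eq_of_uIcc {M : ℝ → ℤ} (hM : Monotone M) {y y' w : ℝ} (e : M y = M y')
    (hw : w ∈ uIcc y y') : M w = M y := by
  have := hM.image_uIcc_subset ⟨w, hw, rfl⟩
  simpa [e] using this

/-- Hörmander's step: the sign diagram of `p` together with `P` is determined by that of `p`,
`P'` and polynomials that agree in sign with `P` at the zeros of these. -/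
theorem SignEquiv.insert_of_derivative {ι : Type*} [Finite ι] {p q r s : ι → ℝ[X]} {P Q : ℝ[X]}
    (h : SignEquiv (Sum.elim p r) (Sum.elim q s)) (i₀ : ι) (hp : p i₀ = P.derivative)
    (hq : q i₀ = Q.derivative)
    (hr : ∀ i, p i ≠ 0 → ∀ y, (p i).eval y = 0 → sign ((r i).eval y) = sign (P.eval y))
    (hs : ∀ i, q i ≠ 0 → ∀ y, (q i).eval y = 0 → sign ((s i).eval y) = sign (Q.eval y))
    (h0 : P.derivative = 0 → Q.derivative = 0 → sign (P.eval 0) = sign (Q.eval 0)) :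
    SignEquiv (fun o : Option ι => o.elim P p) (fun o : Option ι => o.elim Q q) := by
  obtain ⟨M, N, hM, hN, hMN, hsgn⟩ := h
  have hpq : ∀ y z, M y = N z → ∀ i, sign ((p i).eval y) = sign ((q i).eval z) :=
    fun y z e i => hsgn y z e (Sum.inl i)
  have hrs : ∀ y z, M y = N z → ∀ i, sign ((r i).eval y) = sign ((s i).eval z) :=
    fun y z e i => hsgn y z e (Sum.inr i)
  have hzero : ∀ i, p i = 0 ↔ q i = 0 := by
    intro i
    constructor
    · intro e
      refine Polynomial.funext fun z => ?_
      obtain ⟨y, hy⟩ : N z ∈ range M := hMN ▸ mem_range_self z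
      have := hpq y z hy i
      rw [e, eval_zero, sign_zero, eq_comm, sign_eq_zero_iff] at this
      rw [this, eval_zero]
    · intro e
      refine Polynomial.funext fun y => ?_
      obtain ⟨z, hz⟩ : M y ∈ range N := hMN ▸ mem_range_self y
      have := hpq y z hz.symm i
      rw [e, eval_zero, sign_zero, sign_eq_zero_iff] at this
      rw [this, eval_zero]
  -- A constant `P` needs separate treatment, as the zeros of `P'` would not form a finite set.
  by_cases hd : P.derivative = 0
  · have hd' : Q.derivative = 0 := by rw [← hq, ← hzero, hp, hd]
    refine ⟨M, N, hM, hN, hMN, fun y z e o => ?_⟩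
    cases o with
    | some i => exact hpq y z e i
    | none =>
      have h1 := h0 hd hd'
      rw [eq_C_of_derivative_eq_zero hd, eq_C_of_derivative_eq_zero hd'] at h1 ⊢
      simpa using h1
  have hd' : Q.derivative ≠ 0 := by rwa [← hq, Ne, ← hzero, hp]
  have hfin : ∀ p : ι → ℝ[X], {y | ∃ i, p i ≠ 0 ∧ (p i).eval y = 0}.Finite := by
    intro p
    have : {y | ∃ i, p i ≠ 0 ∧ (p i).eval y = 0} = ⋃ i, {y | p i ≠ 0 ∧ (p i).eval y = 0} := by
      ext y; simp
    rw [this]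
    refine Set.finite_iUnion fun i => ?_
    by_cases hi : p i = 0
    · simp [hi]
    · refine ((p i).rootSet_finite ℝ).subset fun y hy => ?_
      rw [mem_rootSet]
      exact ⟨hi, by simpa using hy.2⟩
  -- If another point had the same label, monotonicity would make the label constant on the interval
  -- between them, and the nonzero polynomial `p i` would vanish on that interval.
  have hinj : ∀ {p q : ι → ℝ[X]} {M N : ℝ → ℤ}, Monotone M → range M = range N →
      (∀ y z, M y = N z → ∀ i, sign ((p i).eval y) = sign ((q i).eval z)) →
      ∀ y y', y ∈ {y | ∃ i, p i ≠ 0 ∧ (p i).eval y = 0} → M y = M y' → y = y' := by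
    rintro p q M N hM hMN hpq y y' ⟨i, hi, hiy⟩ e
    by_contra hne
    obtain ⟨z, hz⟩ : M y ∈ range N := hMN ▸ mem_range_self y
    refine hi (Polynomial.eq_zero_of_infinite_isRoot _ ?_)
    have hinf : (uIcc y y').Infinite := by
      rw [uIcc]; exact Set.Icc_infinite (inf_lt_sup.2 hne)
    refine hinf.mono fun w hw => ?_
    have h1 := hpq w z ((hM.eq_of_uIcc e hw).trans hz.symm) i
    have h2 := hpq y z hz.symm i
    rw [← h2, hiy, sign_zero, sign_eq_zero_iff] at h1
    exact h1
  have hcm : CellMatch P Q {y | ∃ i, p i ≠ 0 ∧ (p i).eval y = 0}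
      {y | ∃ i, q i ≠ 0 ∧ (q i).eval y = 0} M N :=
    { mono_left := hM
      mono_right := hN
      range_eq := hMN
      finite_left := hfin p
      finite_right := hfin q
      mem_iff := by
        intro y z e
        refine exists_congr fun i => ?_
        rw [Ne, hzero, ← sign_eq_zero_iff (a := (p i).eval y), hpq y z e i, sign_eq_zero_iff]
      inj_left := hinj hM hMN hpq
      inj_right := hinj hN hMN.symm fun y z e i => (hpq z y e.symm i).symm
      sign_eq := by
        rintro y z e ⟨i, hi, hiy⟩
        rw [← hr i hi y hiy, ← hs i (by rwa [Ne, ← hzero]) z, hrs y z e i]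
        rw [← sign_eq_zero_iff, ← hpq y z e i, hiy, sign_zero]
      sign_deriv := by
        intro y z e
        rw [← hp, ← hq, hpq y z e i₀]
      deriv_left := fun y hy => ⟨i₀, by rwa [hp], by rwa [hp]⟩
      deriv_right := fun y hy => ⟨i₀, by rwa [hq], by rwa [hq]⟩ }
  obtain ⟨M', N', h1, h2, h3, h4⟩ := hcm.exists_refinement
  refine ⟨M', N', h1, h2, h3, fun y z e o => ?_⟩
  obtain ⟨h5, y₀, hy₀, hc⟩ := h4 y z e
  cases o with
  | none => exact h5
  | some i =>
    refine Eq.trans ?_ (hpq y₀ z hy₀ i)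
    rcases hc with rfl | hc
    · rfl
    · by_cases hi : p i = 0
      · simp [hi]
      · exact ((p i).sign_eval_eq_of_forall_ne_zero y₀ y fun w hw hw0 => hc w hw ⟨i, hi, hw0⟩).symm

/-! ### Semialgebraic sets and piecewise polynomial functions -/

/-- The polynomials in `F` have the same signs at `x` and at `y`. -/
def SameSign {σ : Type} (F : Set (MvPolynomial σ ℝ)) (x y : σ → ℝ) : Prop :=
  ∀ f ∈ F, sign (MvPolynomial.eval x f) = sign (MvPolynomial.eval y f)

theorem SameSign.mono {σ : Type} {F F' : Set (MvPolynomial σ ℝ)} {x y : σ → ℝ}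
    (h : SameSign F' x y) (hF : F ⊆ F') : SameSign F x y := fun f hf => h f (hF hf)

theorem SameSign.symm {σ : Type} {F : Set (MvPolynomial σ ℝ)} {x y : σ → ℝ}
    (h : SameSign F x y) : SameSign F y x := fun f hf => (h f hf).symm

/-- Semialgebraic sets: membership is determined by the signs of finitely many polynomials. -/
def Semialgebraic {σ : Type} (S : Set (σ → ℝ)) : Prop :=
  ∃ F : Set (MvPolynomial σ ℝ), F.Finite ∧ ∀ x y, SameSign F x y → x ∈ S → y ∈ S

theorem Semialgebraic.compl {σ : Type} {S : Set (σ → ℝ)} (h : Semialgebraic S) :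
    Semialgebraic Sᶜ := by
  obtain ⟨F, hF, h⟩ := h
  exact ⟨F, hF, fun x y hxy hx hy => hx (h y x hxy.symm hy)⟩

theorem Semialgebraic.union {σ : Type} {S T : Set (σ → ℝ)} (hS : Semialgebraic S)
    (hT : Semialgebraic T) : Semialgebraic (S ∪ T) := by
  obtain ⟨F, hF, hS⟩ := hS
  obtain ⟨G, hG, hT⟩ := hT
  exact ⟨F ∪ G, hF.union hG, fun x y hxy hx =>
    hx.imp (hS x y (hxy.mono subset_union_left)) (hT x y (hxy.mono subset_union_right))⟩

theorem Semialgebraic.preimage_comp {σ τ : Type} (g : σ → τ) {S : Set (σ → ℝ)}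
    (h : Semialgebraic S) : Semialgebraic {x : τ → ℝ | x ∘ g ∈ S} := by
  obtain ⟨F, hF, h⟩ := h
  refine ⟨MvPolynomial.rename g '' F, hF.image _, fun x y hxy hx => h _ _ (fun f hf => ?_) hx⟩
  simpa [MvPolynomial.eval_rename] using hxy _ ⟨f, hf, rfl⟩

/-- Functions that are polynomial on each class of a finite semialgebraic partition. -/
def PiecewisePoly {σ : Type} (a : (σ → ℝ) → ℝ) : Prop :=
  ∃ F G : Set (MvPolynomial σ ℝ), F.Finite ∧ G.Finite ∧ ∀ x₀, ∃ p ∈ G, ∀ x, SameSign F x₀ x →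
    a x = MvPolynomial.eval x p

theorem PiecewisePoly.eval {σ : Type} (p : MvPolynomial σ ℝ) :
    PiecewisePoly fun x => MvPolynomial.eval x p :=
  ⟨∅, {p}, finite_empty, finite_singleton _, fun _ => ⟨p, rfl, fun _ _ => rfl⟩⟩

theorem PiecewisePoly.zero {σ : Type} : PiecewisePoly fun _ : σ → ℝ => 0 := by
  simpa using PiecewisePoly.eval (0 : MvPolynomial σ ℝ)

theorem PiecewisePoly.map₂ {σ : Type} {a b : (σ → ℝ) → ℝ} (ha : PiecewisePoly a)
    (hb : PiecewisePoly b) (u : ℝ → ℝ → ℝ)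
    (v : MvPolynomial σ ℝ → MvPolynomial σ ℝ → MvPolynomial σ ℝ)
    (huv : ∀ x p q, MvPolynomial.eval x (v p q) =
      u (MvPolynomial.eval x p) (MvPolynomial.eval x q)) :
    PiecewisePoly fun x => u (a x) (b x) := by
  obtain ⟨F, G, hF, hG, ha⟩ := ha
  obtain ⟨F', G', hF', hG', hb⟩ := hb
  refine ⟨F ∪ F', image2 v G G', hF.union hF', hG.image2 _ hG', fun x₀ => ?_⟩
  obtain ⟨p, hp, hpa⟩ := ha x₀
  obtain ⟨q, hq, hqb⟩ := hb x₀
  refine ⟨v p q, mem_image2_of_mem hp hq, fun x hx => ?_⟩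
  dsimp only
  rw [hpa x (hx.mono subset_union_left), hqb x (hx.mono subset_union_right), huv]

theorem PiecewisePoly.mul {σ : Type} {a b : (σ → ℝ) → ℝ} (ha : PiecewisePoly a)
    (hb : PiecewisePoly b) : PiecewisePoly fun x => a x * b x :=
  ha.map₂ hb (· * ·) (· * ·) (by simp)

theorem PiecewisePoly.sub {σ : Type} {a b : (σ → ℝ) → ℝ} (ha : PiecewisePoly a)
    (hb : PiecewisePoly b) : PiecewisePoly fun x => a x - b x :=
  ha.map₂ hb (· - ·) (· - ·) (by simp)

open Classical in
theorem PiecewisePoly.ite {σ : Type} {a b : (σ → ℝ) → ℝ} {S : Set (σ → ℝ)}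
    (hS : Semialgebraic S) (ha : PiecewisePoly a) (hb : PiecewisePoly b) :
    PiecewisePoly fun x => if x ∈ S then a x else b x := by
  obtain ⟨H, hH, hS⟩ := hS
  obtain ⟨F, G, hF, hG, ha⟩ := ha
  obtain ⟨F', G', hF', hG', hb⟩ := hb
  refine ⟨H ∪ (F ∪ F'), G ∪ G', hH.union (hF.union hF'), hG.union hG', fun x₀ => ?_⟩
  have h1 : H ⊆ H ∪ (F ∪ F') := subset_union_left
  have h2 : F ⊆ H ∪ (F ∪ F') := subset_union_left.trans subset_union_right
  have h3 : F' ⊆ H ∪ (F ∪ F') := subset_union_right.trans subset_union_right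
  by_cases hx₀ : x₀ ∈ S
  · obtain ⟨p, hp, hpa⟩ := ha x₀
    refine ⟨p, Or.inl hp, fun x hx => ?_⟩
    dsimp only
    rw [if_pos (hS _ _ (hx.mono h1) hx₀), hpa x (hx.mono h2)]
  · obtain ⟨p, hp, hpa⟩ := hb x₀
    refine ⟨p, Or.inr hp, fun x hx => ?_⟩
    dsimp only
    rw [if_neg fun h => hx₀ (hS _ _ (hx.mono h1).symm h), hpa x (hx.mono h3)]

/-- Adding the finitely many pieces themselves to the partitioning polynomials makes the sign
constant on each class. -/
theorem PiecewisePoly.exists_sign_eq {σ : Type} {a : (σ → ℝ) → ℝ} (ha : PiecewisePoly a) :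
    ∃ F : Set (MvPolynomial σ ℝ), F.Finite ∧ ∀ x y, SameSign F x y → sign (a x) = sign (a y) := by
  obtain ⟨F, G, hF, hG, ha⟩ := ha
  refine ⟨F ∪ G, hF.union hG, fun x y hxy => ?_⟩
  obtain ⟨p, hp, hpa⟩ := ha x
  rw [hpa x fun _ _ => rfl, hpa y (hxy.mono subset_union_left)]
  exact hxy p (Or.inr hp)

theorem PiecewisePoly.semialgebraic_zero {σ : Type} {a : (σ → ℝ) → ℝ} (ha : PiecewisePoly a) :
    Semialgebraic {x | a x = 0} := by
  obtain ⟨F, hF, h⟩ := ha.exists_sign_eq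
  refine ⟨F, hF, fun x y hxy hx => ?_⟩
  have hx : a x = 0 := hx
  have := h x y hxy
  rw [hx, sign_zero, eq_comm, sign_eq_zero_iff] at this
  exact this

/-! ### Remainders with parameters and stratification by sign diagrams -/

/-- Families of polynomials of degree at most `d` whose coefficients are piecewise polynomial. -/
def PolyFamily {σ : Type} (d : ℕ) (P : (σ → ℝ) → ℝ[X]) : Prop :=
  (∀ x, (P x).natDegree ≤ d) ∧ ∀ k, PiecewisePoly fun x => (P x).coeff k

theorem PolyFamily.mono {σ : Type} {d e : ℕ} {P : (σ → ℝ) → ℝ[X]} (h : PolyFamily d P)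
    (hde : d ≤ e) : PolyFamily e P := ⟨fun x => (h.1 x).trans hde, h.2⟩

theorem PolyFamily.derivative {σ : Type} {d : ℕ} {P : (σ → ℝ) → ℝ[X]} (h : PolyFamily (d + 1) P) :
    PolyFamily d fun x => (P x).derivative := by
  refine ⟨fun x => (natDegree_derivative_le _).trans (by have := h.1 x; omega), fun k => ?_⟩
  simp only [coeff_derivative]
  have := (h.2 (k + 1)).mul (PiecewisePoly.eval (MvPolynomial.C ((k : ℝ) + 1)))
  simpa using this

open Classical in
theorem PolyFamily.ite {σ : Type} {d : ℕ} {P Q : (σ → ℝ) → ℝ[X]} {S : Set (σ → ℝ)}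
    (hS : Semialgebraic S) (hP : PolyFamily d P) (hQ : PolyFamily d Q) :
    PolyFamily d fun x => if x ∈ S then P x else Q x := by
  refine ⟨fun x => ?_, fun k => ?_⟩
  · dsimp only
    split_ifs
    · exact hP.1 x
    · exact hQ.1 x
  · convert PiecewisePoly.ite hS (hP.2 k) (hQ.2 k) using 2
    dsimp only
    split_ifs <;> rfl

theorem PolyFamily.zero {σ : Type} (d : ℕ) : PolyFamily d fun _ : σ → ℝ => (0 : ℝ[X]) :=
  ⟨fun x => by simp, fun k => by simpa using PiecewisePoly.zero⟩

/-- Pseudo-division. Multiplying the dividend by the square of the leading coefficient of `p` avoids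
division and changes no sign at the zeros of `p`. -/
theorem PolyFamily.exists_remainder_of_leadingCoeff {σ : Type} {e : ℕ} {p : (σ → ℝ) → ℝ[X]}
    (hp : PolyFamily (e + 1) p) (n : ℕ) : ∀ P : (σ → ℝ) → ℝ[X], PolyFamily n P →
    ∃ r, PolyFamily e r ∧ ∀ x, (p x).coeff (e + 1) ≠ 0 → ∀ y, (p x).eval y = 0 →
      sign ((r x).eval y) = sign ((P x).eval y) := by
  induction n with
  | zero => exact fun P hP => ⟨P, hP.mono (Nat.zero_le _), fun _ _ _ _ => rfl⟩
  | succ m ih =>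
    intro P hP
    by_cases hme : m + 1 ≤ e
    · exact ⟨P, hP.mono hme, fun _ _ _ _ => rfl⟩
    push Not at hme
    -- The shift `X ^ (m - e)` raises the top degree of `p` from `e + 1` to `m + 1`, where the
    -- leading terms cancel.
    have hQ : PolyFamily m fun x => C ((p x).coeff (e + 1) * (p x).coeff (e + 1)) * P x -
        C ((p x).coeff (e + 1) * (P x).coeff (m + 1)) * (p x * X ^ (m - e)) := by
      refine ⟨fun x => ?_, fun k => ?_⟩
      · rw [natDegree_le_iff_coeff_eq_zero]
        intro N hN
        have hN' : m - e ≤ N := (Nat.sub_le _ _).trans hN.le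
        rw [coeff_sub, coeff_C_mul, coeff_C_mul, coeff_mul_X_pow', if_pos hN']
        rcases (show m + 1 ≤ N from hN).eq_or_lt with rfl | hlt
        · rw [show m + 1 - (m - e) = e + 1 by omega]
          ring
        · have hlt' : e + 1 < N - (m - e) := by omega
          rw [coeff_eq_zero_of_natDegree_lt ((hP.1 x).trans_lt hlt),
            coeff_eq_zero_of_natDegree_lt ((hp.1 x).trans_lt hlt')]
          ring
      · simp only [coeff_sub, coeff_C_mul, coeff_mul_X_pow']
        refine (((hp.2 _).mul (hp.2 _)).mul (hP.2 k)).sub (((hp.2 _).mul (hP.2 _)).mul ?_)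
        split_ifs
        · exact hp.2 _
        · exact PiecewisePoly.zero
    obtain ⟨r, hr, hrs⟩ := ih _ hQ
    refine ⟨r, hr, fun x hx y hy => ?_⟩
    rw [hrs x hx y hy]
    simp only [eval_sub, eval_mul, eval_C, hy, zero_mul, mul_zero, sub_zero]
    rw [sign_mul, sign_pos (mul_self_pos.2 hx), one_mul]

/-- The true degree of `p x` varies with `x`. The locus where the top coefficient vanishes is
semialgebraic; there the degree bound drops and induction applies, elsewhere pseudo-division does.
-/
theorem PolyFamily.exists_remainder {σ : Type} {d n : ℕ} {P : (σ → ℝ) → ℝ[X]}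
    (hP : PolyFamily n P) (e : ℕ) (hed : e ≤ d + 1) : ∀ p : (σ → ℝ) → ℝ[X], PolyFamily e p →
    ∃ r, PolyFamily d r ∧ ∀ x, p x ≠ 0 → ∀ y, (p x).eval y = 0 →
      sign ((r x).eval y) = sign ((P x).eval y) := by
  induction e with
  | zero =>
    refine fun p hp => ⟨_, PolyFamily.zero d, fun x hx y hy => absurd ?_ hx⟩
    rw [eq_C_of_natDegree_le_zero (hp.1 x)] at hy ⊢
    rw [eval_C] at hy
    rw [hy, C_0]
  | succ e ih =>
    intro p hp
    classical
    have hS := (hp.2 (e + 1)).semialgebraic_zero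
    obtain ⟨r₁, hr₁, h₁⟩ := hp.exists_remainder_of_leadingCoeff n P hP
    -- Off the locus the family is replaced by 0, so that the smaller degree bound holds for every
    -- parameter.
    obtain ⟨r₂, hr₂, h₂⟩ := ih (by omega)
      (fun x => if x ∈ {x | (p x).coeff (e + 1) = 0} then p x else 0) (by
        refine ⟨fun x => ?_, (PolyFamily.ite hS hp (PolyFamily.zero _)).2⟩
        dsimp only
        split_ifs with hx
        · rw [natDegree_le_iff_coeff_eq_zero]
          intro N hN
          rcases (show e + 1 ≤ N from hN).eq_or_lt with rfl | hlt
          · exact hx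
          · exact coeff_eq_zero_of_natDegree_lt ((hp.1 x).trans_lt hlt)
        · simp)
    refine ⟨_, PolyFamily.ite hS hr₂ (hr₁.mono (by omega)), fun x hx y hy => ?_⟩
    by_cases hxS : x ∈ {x | (p x).coeff (e + 1) = 0}
    · have := h₂ x
      simp only [if_pos hxS] at this ⊢
      exact this hx y hy
    · simp only [if_neg hxS]
      exact h₁ x hxS y hy

/-- The sign diagrams of a finite set of families are determined by the signs of finitely many
polynomials in the parameters. -/
def SignStratified {σ : Type} (A : Set ((σ → ℝ) → ℝ[X])) : Prop :=
  ∃ F : Set (MvPolynomial σ ℝ), F.Finite ∧ ∀ x x', SameSign F x x' →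
    SignEquiv (fun P : A => P.1 x) (fun P : A => P.1 x')

theorem SignEquiv.of_forall_exists {ι κ : Type*} {p q : ι → ℝ[X]} {p' q' : κ → ℝ[X]}
    (h : SignEquiv p q) (hpq : ∀ j, ∃ i, p' j = p i ∧ q' j = q i) : SignEquiv p' q' := by
  choose f hf using hpq
  rw [show p' = p ∘ f from funext fun j => (hf j).1, show q' = q ∘ f from funext fun j => (hf j).2]
  exact h.comp f

theorem exists_finite_sameSign {σ ι : Type} {A : Set ι} (hA : A.Finite)
    (R : ι → (σ → ℝ) → (σ → ℝ) → Prop)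
    (h : ∀ i ∈ A, ∃ F : Set (MvPolynomial σ ℝ), F.Finite ∧ ∀ x y, SameSign F x y → R i x y) :
    ∃ F : Set (MvPolynomial σ ℝ), F.Finite ∧ ∀ x y, SameSign F x y → ∀ i ∈ A, R i x y := by
  choose! F hF hR using h
  exact ⟨⋃ i ∈ A, F i, hA.biUnion hF, fun x y hxy i hi =>
    hR i hi x y (hxy.mono (subset_biUnion_of_mem hi))⟩

theorem signStratified_zero {σ : Type} {A : Set ((σ → ℝ) → ℝ[X])} (hA : A.Finite)
    (h : ∀ P ∈ A, PolyFamily 0 P) : SignStratified A := by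
  obtain ⟨F, hF, hs⟩ := exists_finite_sameSign hA
    (fun P x y => sign ((P x).coeff 0) = sign ((P y).coeff 0))
    (fun P hP => ((h P hP).2 0).exists_sign_eq)
  refine ⟨F, hF, fun x x' hxx => ⟨fun _ => 0, fun _ => 0, monotone_const, monotone_const, rfl,
    fun y z _ P => ?_⟩⟩
  have := hs x x' hxx P.1 P.2
  dsimp only
  rw [eq_C_of_natDegree_le_zero ((h P.1 P.2).1 x), eq_C_of_natDegree_le_zero ((h P.1 P.2).1 x')]
  simpa using this

/-- `P'` and the remainders of `P` modulo `P'` and the members of `A` all have degree at most `d`,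
so `P` is traded for finitely many families of lower degree. -/
theorem signStratified_insert {σ : Type} {d : ℕ} {A : Set ((σ → ℝ) → ℝ[X])} (hA : A.Finite)
    (hAd : ∀ P ∈ A, PolyFamily (d + 1) P) {P : (σ → ℝ) → ℝ[X]} (hP : PolyFamily (d + 1) P)
    (ih : ∀ B : Set ((σ → ℝ) → ℝ[X]), B.Finite → (∀ Q ∈ B, PolyFamily d Q) →
      SignStratified (A ∪ B)) : SignStratified (insert P A) := by
  let P' : (σ → ℝ) → ℝ[X] := fun x => (P x).derivative
  have hP' : PolyFamily d P' := hP.derivative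
  have hT : ∀ p ∈ insert P' A, ∃ r, PolyFamily d r ∧ ∀ x, p x ≠ 0 → ∀ y, (p x).eval y = 0 →
      sign ((r x).eval y) = sign ((P x).eval y) := by
    intro p hp
    refine hP.exists_remainder (d + 1) le_rfl p ?_
    rcases hp with rfl | hp
    · exact hP'.mono (by omega)
    · exact hAd p hp
  choose! r hrd hr using hT
  have hfin : (insert P' A).Finite := hA.insert P'
  obtain ⟨F, hF, hFE⟩ := ih (insert P' (r '' insert P' A)) ((hfin.image r).insert _) (by
    rintro Q (rfl | ⟨p, hp, rfl⟩)
    · exact hP'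
    · exact hrd p hp)
  obtain ⟨G, hG, hGs⟩ := (hP.2 0).exists_sign_eq
  refine ⟨F ∪ G, hF.union hG, fun x x' hxx => ?_⟩
  have hE := hFE x x' (hxx.mono subset_union_left)
  have h0 := hGs x x' (hxx.mono subset_union_right)
  have := hfin.to_subtype
  have key := SignEquiv.insert_of_derivative (ι := ↥(insert P' A)) (p := fun p => p.1 x)
    (q := fun p => p.1 x') (r := fun p => r p.1 x) (s := fun p => r p.1 x') (P := P x)
    (Q := P x') (hE.of_forall_exists ?_) ⟨P', mem_insert _ _⟩ rfl rfl
    (fun p hp y hy => hr p.1 p.2 x hp y hy) (fun p hp y hy => hr p.1 p.2 x' hp y hy)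
    (fun _ _ => by simpa only [coeff_zero_eq_eval_zero] using h0)
  · refine key.of_forall_exists ?_
    rintro ⟨Q, rfl | hQ⟩
    · exact ⟨none, rfl, rfl⟩
    · exact ⟨some ⟨Q, mem_insert_of_mem _ hQ⟩, rfl, rfl⟩
  · rintro (⟨Q, rfl | hQ⟩ | Q)
    · exact ⟨⟨P', Or.inr (mem_insert _ _)⟩, rfl, rfl⟩
    · exact ⟨⟨Q, Or.inl hQ⟩, rfl, rfl⟩
    · exact ⟨⟨r Q.1, Or.inr (mem_insert_of_mem _ (mem_image_of_mem r Q.2))⟩, rfl, rfl⟩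

theorem signStratified_of_polyFamily {σ : Type} (d : ℕ) : ∀ A : Set ((σ → ℝ) → ℝ[X]), A.Finite →
    (∀ P ∈ A, PolyFamily d P) → SignStratified A := by
  induction d with
  | zero => exact fun A hA h => signStratified_zero hA h
  | succ d ih =>
    -- Inner induction on the number of families of degree `d + 1`. The set `B` of lower degree must
    -- stay arbitrary, since each removal from `A` enlarges it.
    have key : ∀ A : Set ((σ → ℝ) → ℝ[X]), A.Finite → (∀ P ∈ A, PolyFamily (d + 1) P) →
        ∀ B : Set ((σ → ℝ) → ℝ[X]), B.Finite → (∀ P ∈ B, PolyFamily d P) →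
          SignStratified (A ∪ B) := by
      intro A hA
      induction A, hA using Set.Finite.induction_on with
      | empty => intro _ B hB hBd; rw [empty_union]; exact ih B hB hBd
      | @insert P A _ hA ihA =>
        intro hPA B hB hBd
        rw [insert_union]
        refine signStratified_insert (hA.union hB) ?_ (hPA P (mem_insert _ _)) fun B' hB' hBd' => ?_
        · rintro Q (hQ | hQ)
          · exact hPA Q (mem_insert_of_mem _ hQ)
          · exact (hBd Q hQ).mono (by omega)
        · rw [union_assoc]
          exact ihA (fun Q hQ => hPA Q (mem_insert_of_mem _ hQ)) _ (hB.union hB')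
            fun Q hQ => hQ.elim (hBd Q) (hBd' Q)
    intro A hA h
    simpa using key A hA h ∅ finite_empty (by simp)

/-! ### Quantifier elimination -/

/-- Tarski–Seidenberg. -/
theorem Semialgebraic.exists {σ : Type} {S : Set (Option σ → ℝ)} (hS : Semialgebraic S) :
    Semialgebraic {x : σ → ℝ | ∃ y : ℝ, (fun o : Option σ => o.elim y x) ∈ S} := by
  obtain ⟨F, hF, hS⟩ := hS
  -- The quantified variable `none` becomes the polynomial variable; the other variables are
  -- parameters in the coefficients.
  let fam : MvPolynomial (Option σ) ℝ → (σ → ℝ) → ℝ[X] := fun f x =>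
    (MvPolynomial.optionEquivLeft ℝ σ f).map (MvPolynomial.eval x)
  obtain ⟨d, hd⟩ := (hF.image fun f => (MvPolynomial.optionEquivLeft ℝ σ f).natDegree).bddAbove
  obtain ⟨G, hG, hGE⟩ := signStratified_of_polyFamily d (fam '' F) (hF.image _) (by
    rintro _ ⟨f, hf, rfl⟩
    refine ⟨fun x => natDegree_map_le.trans (hd ⟨f, hf, rfl⟩), fun k => ?_⟩
    simpa only [fam, coeff_map] using PiecewisePoly.eval _)
  refine ⟨G, hG, fun x x' hxx hx => ?_⟩
  obtain ⟨y, hy⟩ := hx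
  obtain ⟨y', hy'⟩ := (hGE x x' hxx).exists_sign_eq y
  refine ⟨y', hS _ _ (fun f hf => ?_) hy⟩
  rw [MvPolynomial.optionEquivLeft_elim_eval, MvPolynomial.optionEquivLeft_elim_eval]
  exact hy' ⟨fam f, mem_image_of_mem _ hf⟩

open FirstOrder FirstOrder.Language in
theorem exists_eval_eq_realize {σ : Type}
    (t : letI := FirstOrder.Ring.compatibleRingOfRing ℝ
      (FirstOrder.Language.ring[[(Set.univ : Set ℝ)]]).Term σ) :
    letI := FirstOrder.Ring.compatibleRingOfRing ℝ
    ∃ p : MvPolynomial σ ℝ, ∀ w : σ → ℝ, t.realize w = MvPolynomial.eval w p := by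
  let := FirstOrder.Ring.compatibleRingOfRing ℝ
  induction t with
  | var i => exact ⟨MvPolynomial.X i, fun w => by simp⟩
  | @func l f ts ih =>
    choose p hp using ih
    rcases f with f | f
    · cases f with
      | add =>
        refine ⟨p 0 + p 1, fun w => ?_⟩
        rw [map_add, ← hp, ← hp]
        rfl
      | mul =>
        refine ⟨p 0 * p 1, fun w => ?_⟩
        rw [map_mul, ← hp, ← hp]
        rfl
      | neg =>
        refine ⟨-p 0, fun w => ?_⟩
        rw [map_neg, ← hp]
        rfl
      | zero => exact ⟨0, fun w => by rw [map_zero]; rfl⟩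
      | one => exact ⟨1, fun w => by rw [map_one]; rfl⟩
    · cases l with
      | zero => exact ⟨MvPolynomial.C (f : ↥(Set.univ : Set ℝ)).1, fun w => by
          rw [MvPolynomial.eval_C]; rfl⟩
      | succ l => exact PEmpty.elim f

open FirstOrder FirstOrder.Language in
theorem semialgebraic_realize {ι : Type} {n : ℕ}
    (φ : letI := FirstOrder.Ring.compatibleRingOfRing ℝ
      (FirstOrder.Language.ring[[(Set.univ : Set ℝ)]]).BoundedFormula ι n) :
    letI := FirstOrder.Ring.compatibleRingOfRing ℝ
    Semialgebraic {w : ι ⊕ Fin n → ℝ | φ.Realize (w ∘ Sum.inl) (w ∘ Sum.inr)} := by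
  let := FirstOrder.Ring.compatibleRingOfRing ℝ
  induction φ with
  | falsum => exact ⟨∅, finite_empty, fun x y _ hx => hx⟩
  | @equal n t₁ t₂ =>
    obtain ⟨p₁, h₁⟩ := exists_eval_eq_realize t₁
    obtain ⟨p₂, h₂⟩ := exists_eval_eq_realize t₂
    convert (PiecewisePoly.eval (p₁ - p₂)).semialgebraic_zero using 1
    ext w
    have hw : Sum.elim (w ∘ Sum.inl) (w ∘ Sum.inr) = w := Sum.elim_comp_inl_inr w
    change t₁.realize (Sum.elim (w ∘ Sum.inl) (w ∘ Sum.inr)) =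
      t₂.realize (Sum.elim (w ∘ Sum.inl) (w ∘ Sum.inr)) ↔ MvPolynomial.eval w (p₁ - p₂) = 0
    rw [hw, h₁, h₂, map_sub, sub_eq_zero]
  | rel R => exact R.elim Empty.elim Empty.elim
  | @imp n φ ψ ihφ ihψ =>
    convert ihφ.compl.union ihψ using 1
    ext w
    exact imp_iff_not_or
  | @all n φ ih =>
    -- The last bound variable is renamed `none`, and ∀ is treated as ¬∃¬.
    let g : ι ⊕ Fin (n + 1) → Option (ι ⊕ Fin n) :=
      Sum.elim (fun i => some (Sum.inl i)) (Fin.snoc (fun j => some (Sum.inr j)) none)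
    convert (ih.preimage_comp g).compl.exists.compl using 1
    ext w
    change (∀ a : ℝ, φ.Realize (w ∘ Sum.inl) (Fin.snoc (w ∘ Sum.inr) a)) ↔
      ¬ ∃ y : ℝ, ¬ φ.Realize _ _
    push Not
    refine forall_congr' fun a => ?_
    have e : (((fun o : Option (ι ⊕ Fin n) => o.elim a w) ∘ g) ∘ Sum.inr) =
        (Fin.snoc (w ∘ Sum.inr) a : Fin (n + 1) → ℝ) := by
      funext j
      refine Fin.lastCases ?_ (fun j => ?_) j
      · simp [g]
      · simp [g]
    rw [e]
    rfl

/-- Quantifier elimination for the real field. -/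
theorem RDefinable.semialgebraic {ι : Type} {S : Set (ι → ℝ)} (hS : RDefinable S) :
    Semialgebraic S := by
  let := FirstOrder.Ring.compatibleRingOfRing ℝ
  obtain ⟨φ, rfl⟩ := hS
  convert (semialgebraic_realize φ).preimage_comp (Sum.elim id (fun i : Fin 0 => i.elim0)) using 1
  ext x
  change FirstOrder.Language.BoundedFormula.Realize φ _ _ ↔
    FirstOrder.Language.BoundedFormula.Realize φ _ _
  rw [Subsingleton.elim ((x ∘ Sum.elim id fun i : Fin 0 => i.elim0) ∘ Sum.inr)
    (@default (Fin 0 → ℝ) Unique.instInhabited)]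
  rfl

/-! ### Closure properties of definable functions and sets -/

/-- Functions that are definable, with parameters, in the real field. -/
@[fun_prop]
def RFun {ι : Type} (f : (ι → ℝ) → ℝ) : Prop :=
  letI := FirstOrder.Ring.compatibleRingOfRing ℝ
  (Set.univ : Set ℝ).DefinableFun FirstOrder.Language.ring f

@[fun_prop]
theorem RFun.proj {ι : Type} (i : ι) : RFun fun v : ι → ℝ => v i :=
  let := FirstOrder.Ring.compatibleRingOfRing ℝ
  DefinableFun.proj FirstOrder.Language.ring

@[fun_prop]
theorem RFun.const {ι : Type} (a : ℝ) : RFun fun _ : ι → ℝ => a :=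
  let := FirstOrder.Ring.compatibleRingOfRing ℝ
  FirstOrder.Language.definableFun_const _ ι (mem_univ a)

theorem RFun.of_term {ι : Type} {n : ℕ} (F : FirstOrder.Language.ring.Functions n)
    {g : (ι → ℝ) → Fin n → ℝ} (hg : ∀ i, RFun fun v => g v i) :
    let := FirstOrder.Ring.compatibleRingOfRing ℝ
    RFun fun v => FirstOrder.Language.Structure.funMap F (g v) := by
  intro _
  exact DefinableFun.comp (f := FirstOrder.Language.Structure.funMap F) hg
    (DefinableFun.of_empty (DefinableFun.fun_symbol F))

@[fun_prop]
theorem RFun.add {ι : Type} {f g : (ι → ℝ) → ℝ} (hf : RFun f) (hg : RFun g) :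
    RFun fun v => f v + g v :=
  RFun.of_term FirstOrder.Ring.addFunc (g := fun v => ![f v, g v]) (by simp [Fin.forall_fin_two, hf, hg])

@[fun_prop]
theorem RFun.mul {ι : Type} {f g : (ι → ℝ) → ℝ} (hf : RFun f) (hg : RFun g) :
    RFun fun v => f v * g v :=
  RFun.of_term FirstOrder.Ring.mulFunc (g := fun v => ![f v, g v]) (by simp [Fin.forall_fin_two, hf, hg])

@[fun_prop]
theorem RFun.neg {ι : Type} {f : (ι → ℝ) → ℝ} (hf : RFun f) : RFun fun v => -f v :=
  RFun.of_term FirstOrder.Ring.negFunc (g := fun v => ![f v]) (by simp [hf])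

@[fun_prop]
theorem RFun.sub {ι : Type} {f g : (ι → ℝ) → ℝ} (hf : RFun f) (hg : RFun g) :
    RFun fun v => f v - g v := by
  simp only [sub_eq_add_neg]
  fun_prop

@[fun_prop]
theorem RFun.pow {ι : Type} {f : (ι → ℝ) → ℝ} (hf : RFun f) (n : ℕ) :
    RFun fun v => f v ^ n := by
  induction n with
  | zero => simpa using RFun.const 1
  | succ n ih => simp only [pow_succ]; fun_prop

theorem RDefinable.and {ι : Type} {p q : (ι → ℝ) → Prop} (hp : RDefinable {v | p v})
    (hq : RDefinable {v | q v}) : RDefinable {v | p v ∧ q v} :=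
  let := FirstOrder.Ring.compatibleRingOfRing ℝ
  Definable.inter hp hq

theorem RDefinable.or {ι : Type} {p q : (ι → ℝ) → Prop} (hp : RDefinable {v | p v})
    (hq : RDefinable {v | q v}) : RDefinable {v | p v ∨ q v} :=
  let := FirstOrder.Ring.compatibleRingOfRing ℝ
  Definable.union hp hq

theorem RDefinable.not {ι : Type} {p : (ι → ℝ) → Prop} (hp : RDefinable {v | p v}) :
    RDefinable {v | ¬ p v} :=
  let := FirstOrder.Ring.compatibleRingOfRing ℝ
  Definable.compl hp

theorem RDefinable.forall_fin {ι : Type} {n : ℕ} {p : Fin n → (ι → ℝ) → Prop}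
    (hp : ∀ i, RDefinable {v | p i v}) : RDefinable {v | ∀ i, p i v} := by
  let := FirstOrder.Ring.compatibleRingOfRing ℝ
  have := definable_iInter_of_finite hp
  rwa [← ofPred_forall] at this

theorem RDefinable.eq {ι : Type} {f g : (ι → ℝ) → ℝ} (hf : RFun f) (hg : RFun g) :
    RDefinable {v | f v = g v} :=
  let := FirstOrder.Ring.compatibleRingOfRing ℝ
  DefinableFun.ofPred_eq hf hg

theorem RDefinable.exists {ι κ : Type} [Finite κ] {p : (ι → ℝ) → (κ → ℝ) → Prop}
    (h : RDefinable {w : ι ⊕ κ → ℝ | p (fun i => w (Sum.inl i)) fun k => w (Sum.inr k)}) :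
    RDefinable {v | ∃ u, p v u} := by
  let := FirstOrder.Ring.compatibleRingOfRing ℝ
  exact Definable.exists_of_finite h

theorem RDefinable.preimage {ι κ : Type} [Finite κ] {S : Set (κ → ℝ)} (hS : RDefinable S)
    {F : (ι → ℝ) → κ → ℝ} (hF : ∀ k, RFun fun v => F v k) : RDefinable {v | F v ∈ S} :=
  let := FirstOrder.Ring.compatibleRingOfRing ℝ
  Definable.preimage_map hF hS

/-- The order is definable in the field language because the nonnegative reals are the squares. -/
theorem RDefinable.le {ι : Type} {f g : (ι → ℝ) → ℝ} (hf : RFun f) (hg : RFun g) :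
    RDefinable {v | f v ≤ g v} := by
  have h : RDefinable {w : Fin 2 → ℝ | ∃ u : Fin 1 → ℝ, w 1 - w 0 = u 0 * u 0} :=
    RDefinable.exists (RDefinable.eq (by fun_prop) (by fun_prop))
  convert h.preimage (F := fun v => ![f v, g v]) (by simp [Fin.forall_fin_two, hf, hg]) using 1
  ext v
  simp only [mem_ofPred_eq, Matrix.cons_val_one, Matrix.cons_val_zero]
  constructor
  · intro h
    exact ⟨fun _ => √(g v - f v), (Real.mul_self_sqrt (by linarith)).symm⟩
  · rintro ⟨u, hu⟩
    nlinarith [mul_self_nonneg (u 0)]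

theorem RDefinable.lt {ι : Type} {f g : (ι → ℝ) → ℝ} (hf : RFun f) (hg : RFun g) :
    RDefinable {v | f v < g v} := by
  simpa only [not_le] using (RDefinable.le hg hf).not

/-! ### Definable sets in the line and definable graphs -/

theorem Polynomial.eval_aeval_mvPolynomial {σ : Type} (g : σ → ℝ[X]) (f : MvPolynomial σ ℝ)
    (t : ℝ) : (MvPolynomial.aeval g f).eval t = MvPolynomial.eval (fun i => (g i).eval t) f := by
  induction f using MvPolynomial.induction_on with
  | C a => simp
  | add p q hp hq => simp only [map_add, eval_add, hp, hq]
  | mul_X p i hp => simp only [map_mul, eval_mul, hp, MvPolynomial.aeval_X, MvPolynomial.eval_X]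

theorem Polynomial.finite_setOf_eval_eq_zero {p : ℝ[X]} (hp : p ≠ 0) :
    {t | p.eval t = 0}.Finite :=
  (p.rootSet_finite ℝ).subset fun t ht => (mem_rootSet_of_ne hp).2 (by simpa using ht)

/-- A nonzero polynomial has finitely many zeros, so some interval `(a, a + ε)` contains none; the
sign at its midpoint is the eventual one. -/
theorem Polynomial.eventually_sign_nhdsGT (p : ℝ[X]) (a : ℝ) :
    ∃ s, ∀ᶠ t in 𝓝[>] a, sign (p.eval t) = s := by
  by_cases hp : p = 0
  · exact ⟨0, by simp [hp]⟩
  have hfin : ({t | p.eval t = 0} \ {a}).Finite := (finite_setOf_eval_eq_zero hp).sdiff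
  obtain ⟨ε, hε, hball⟩ := Metric.isOpen_iff.1 hfin.isClosed.isOpen_compl a (by simp)
  refine ⟨sign (p.eval (a + ε / 2)), ?_⟩
  filter_upwards [Ioo_mem_nhdsGT (show a < a + ε by linarith)] with t ht
  refine p.sign_eval_eq_of_forall_ne_zero t (a + ε / 2) fun w hw hw0 => ?_
  have hw' := ordConnected_Ioo.uIcc_subset ht (⟨by linarith, by linarith⟩ :
    a + ε / 2 ∈ Ioo a (a + ε)) hw
  refine @hball w ?_ ⟨hw0, hw'.1.ne'⟩
  rw [Metric.mem_ball, Real.dist_eq, abs_lt]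
  exact ⟨by linarith [hw'.1], by linarith [hw'.2]⟩

theorem Polynomial.eventually_sign_nhdsLT (p : ℝ[X]) (a : ℝ) :
    ∃ s, ∀ᶠ t in 𝓝[<] a, sign (p.eval t) = s := by
  obtain ⟨s, hs⟩ := (p.comp (-X)).eventually_sign_nhdsGT (-a)
  have ht : Tendsto (fun t : ℝ => -t) (𝓝[<] a) (𝓝[>] (-a)) := by
    refine tendsto_nhdsWithin_of_tendsto_nhds_of_eventually_within _
      ((continuous_neg.tendsto a).mono_left nhdsWithin_le_nhds) ?_
    filter_upwards [self_mem_nhdsWithin] with t ht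
    exact neg_lt_neg (show t < a from ht)
  exact ⟨s, (ht.eventually hs).mono fun t h => by simpa using h⟩

/-- Finitely many polynomials decide membership, and each has an eventually constant sign along `l`.
This is the absence of oscillation on which all limits below rest. -/
theorem Semialgebraic.eventually_or {S : Set (Fin 1 → ℝ)} (hS : Semialgebraic S) {l : Filter ℝ}
    (hl : ∀ p : ℝ[X], ∃ s, ∀ᶠ t in l, sign (p.eval t) = s) :
    (∀ᶠ t in l, (fun _ => t) ∈ S) ∨ ∀ᶠ t in l, (fun _ => t) ∉ S := by
  obtain ⟨F, hF, hS⟩ := hS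
  have hl' : ∀ f : MvPolynomial (Fin 1) ℝ, ∃ s, ∀ᶠ t in l,
      sign (MvPolynomial.eval (fun _ => t) f) = s := by
    intro f
    obtain ⟨s, hs⟩ := hl (MvPolynomial.aeval (fun _ => X) f)
    exact ⟨s, by simpa only [Polynomial.eval_aeval_mvPolynomial, eval_X] using hs⟩
  choose s hs using hl'
  have hE : ∀ᶠ t in l, ∀ f ∈ F, sign (MvPolynomial.eval (fun _ => t) f) = s f :=
    (eventually_all_finite hF).2 fun f _ => hs f
  by_cases h : ∃ t, (∀ f ∈ F, sign (MvPolynomial.eval (fun _ => t) f) = s f) ∧ (fun _ => t) ∈ S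
  · obtain ⟨t₀, h1, h2⟩ := h
    exact Or.inl (hE.mono fun t ht => hS _ _ (fun f hf => (h1 f hf).trans (ht f hf).symm) h2)
  · push Not at h
    exact Or.inr (hE.mono h)

/-- In a compact space a map converges along a filter if it does not oscillate with respect to
small neighbourhoods. -/
theorem exists_tendsto_of_eventually_or {α K : Type*} [TopologicalSpace K] [CompactSpace K]
    {l : Filter α} [l.NeBot] {f : α → K}
    (h : ∀ x, ∀ U ∈ 𝓝 x, ∃ V ∈ 𝓝 x, V ⊆ U ∧ ((∀ᶠ t in l, f t ∈ V) ∨ ∀ᶠ t in l, f t ∉ V)) :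
    ∃ x, Tendsto f l (𝓝 x) := by
  obtain ⟨x, hx⟩ := exists_clusterPt_of_compactSpace (map f l)
  refine ⟨x, fun U hU => ?_⟩
  obtain ⟨V, hV, hVU, hor⟩ := h x U hU
  rcases hor with h1 | h1
  · exact h1.mono fun t ht => hVU ht
  · have hfr := (clusterPt_iff_frequently.1 hx) V hV
    exact absurd h1 (frequently_map.1 hfr)

/-- The product of the nonzero defining polynomials works: if none vanished at `(t, f t)`, their
signs would persist after raising the second coordinate slightly, and the graph would contain two
points over `t`. -/
theorem Semialgebraic.exists_polynomial_of_graph {I : Set ℝ} {f : ℝ → ℝ}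
    (h : Semialgebraic {v : Fin 2 → ℝ | v 0 ∈ I ∧ v 1 = f (v 0)}) :
    ∃ Q : MvPolynomial (Fin 2) ℝ, Q ≠ 0 ∧ ∀ t ∈ I, MvPolynomial.eval ![t, f t] Q = 0 := by
  obtain ⟨F, hF, h⟩ := h
  have hF' : (F \ {0}).Finite := hF.sdiff
  refine ⟨∏ p ∈ hF'.toFinset, p, Finset.prod_ne_zero_iff.2 fun p hp => (by simpa using hp : _ ∧ _).2,
    fun t ht => ?_⟩
  rw [map_prod]
  by_contra hne
  replace hne := Finset.prod_ne_zero_iff.1 hne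
  have hev : ∀ᶠ y in 𝓝[>] (f t), ∀ p ∈ F,
      sign (MvPolynomial.eval ![t, f t] p) = sign (MvPolynomial.eval ![t, y] p) := by
    refine (eventually_all_finite hF).2 fun p hp => ?_
    by_cases hp0 : p = 0
    · simp [hp0]
    have hpt := hne p (by simpa using ⟨hp, hp0⟩)
    have hc : Continuous fun y : ℝ => MvPolynomial.eval ![t, y] p := by
      refine (MvPolynomial.continuous_eval p).comp (continuous_pi fun i => ?_)
      fin_cases i
      · exact continuous_const
      · exact continuous_id
    rcases lt_or_gt_of_ne hpt with h0 | h0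
    · filter_upwards [nhdsWithin_le_nhds (hc.tendsto (f t) (gt_mem_nhds h0))] with y hy
      rw [sign_neg h0, sign_neg hy]
    · filter_upwards [nhdsWithin_le_nhds (hc.tendsto (f t) (lt_mem_nhds h0))] with y hy
      rw [sign_pos h0, sign_pos hy]
  obtain ⟨y, hy, hyt⟩ := (hev.and self_mem_nhdsWithin).exists
  have := h ![t, f t] ![t, y] hy ⟨ht, rfl⟩
  exact (ne_of_gt hyt) this.2

/-! ### Transcendence of the cosine and continuous characters of the line -/

/-- The cosine satisfies no polynomial equation on an interval. -/
theorem eq_zero_of_eval_cos_eq_zero {k : ℝ} (hk : k ≠ 0) (Q : MvPolynomial (Fin 2) ℝ)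
    (hQ : ∀ t ∈ Ioo (0 : ℝ) 1, MvPolynomial.eval ![t, Real.cos (k * t)] Q = 0) : Q = 0 := by
  have han : AnalyticOnNhd ℝ (fun t : ℝ => MvPolynomial.eval ![t, Real.cos (k * t)] Q) univ := by
    intro t _
    clear hQ
    induction Q using MvPolynomial.induction_on with
    | C a => simpa using analyticAt_const
    | add p q hp hq =>
      simp only [map_add]
      exact hp.add hq
    | mul_X p i hp =>
      simp only [map_mul, MvPolynomial.eval_X]
      refine hp.mul ?_
      fin_cases i
      · exact analyticAt_id
      · exact (Real.analyticAt_cos).comp (analyticAt_const.mul analyticAt_id)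
  -- Identity theorem for analytic functions.
  have hall : ∀ t, MvPolynomial.eval ![t, Real.cos (k * t)] Q = 0 := by
    intro t
    refine han.eqOn_zero_of_preconnected_of_eventuallyEq_zero isPreconnected_univ
      (mem_univ (1 / 2 : ℝ)) ?_ (mem_univ t)
    filter_upwards [Ioo_mem_nhds (show (0 : ℝ) < 1 / 2 by norm_num) (show (1 / 2 : ℝ) < 1 by norm_num)] with t ht
    exact hQ t ht
  -- The cosine takes the value `c` at infinitely many arguments by periodicity, so `Q(·, c)` has
  -- infinitely many zeros.
  have h1 : ∀ c ∈ Icc (-1 : ℝ) 1, ∀ t, MvPolynomial.eval ![t, c] Q = 0 := by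
    intro c hc t
    have hev : ∀ t, (MvPolynomial.aeval ![X, C c] Q).eval t = MvPolynomial.eval ![t, c] Q := by
      intro t
      rw [Polynomial.eval_aeval_mvPolynomial]
      congr 2
      ext i
      fin_cases i <;> simp
    rw [← hev]
    suffices MvPolynomial.aeval ![X, C c] Q = (0 : ℝ[X]) by rw [this, eval_zero]
    refine eq_zero_of_infinite_isRoot _ (infinite_of_injective_forall_mem
      (f := fun n : ℕ => (Real.arccos c + n * (2 * Real.pi)) / k) ?_ fun n => ?_)
    · intro m n hmn
      have h2 := (div_left_inj' hk).1 hmn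
      have h3 := mul_right_cancel₀ Real.two_pi_pos.ne' (add_left_cancel h2)
      exact_mod_cast h3
    · have := hall ((Real.arccos c + n * (2 * Real.pi)) / k)
      rw [mul_div_cancel₀ _ hk, Real.cos_add_nat_mul_two_pi, Real.cos_arccos hc.1 hc.2] at this
      rw [mem_ofPred_eq, IsRoot.def, hev, this]
  refine MvPolynomial.funext fun v => ?_
  have hev : ∀ y, (MvPolynomial.aeval ![C (v 0), X] Q).eval y = MvPolynomial.eval ![v 0, y] Q := by
    intro t
    rw [Polynomial.eval_aeval_mvPolynomial]
    congr 2
    ext i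
    fin_cases i <;> simp
  have hv : v = ![v 0, v 1] := by
    ext i
    fin_cases i <;> rfl
  rw [map_zero, hv, ← hev]
  suffices MvPolynomial.aeval ![C (v 0), X] Q = (0 : ℝ[X]) by rw [this, eval_zero]
  refine eq_zero_of_infinite_isRoot _ ((Icc_infinite (by norm_num : (-1 : ℝ) < 1)).mono
    fun c hc => ?_)
  rw [mem_ofPred_eq, IsRoot.def, hev, h1 c hc]

/-- A continuous homomorphism from the reals to the unit circle is `t ↦ exp (i k t)`. -/
theorem exists_re_eq_cos_of_continuous {f : ℝ → ℂ} (hc : Continuous f)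
    (hadd : ∀ x y, f (x + y) = f x * f y) (hnorm : ∀ x, ‖f x‖ = 1) :
    ∃ k : ℝ, ∀ x, f x = Complex.exp (k * x * Complex.I) := by
  have h0 : f 0 = 1 := by
    have h1 := hadd 0 0
    rw [add_zero] at h1
    have h2 : f 0 ≠ 0 := fun h => by simpa [h] using hnorm 0
    exact (mul_eq_left₀ h2).1 h1.symm
  have hI : ∀ x, HasDerivAt (fun u => ∫ t in (0 : ℝ)..u, f t) (f x) x := fun x =>
    intervalIntegral.integral_hasDerivAt_right (hc.intervalIntegrable _ _)
      (hc.stronglyMeasurableAtFilter _ _) hc.continuousAt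
  -- Otherwise the primitive of `f` would vanish identically, against its derivative `f 0 = 1` at 0.
  obtain ⟨δ, hδ⟩ : ∃ δ, (∫ t in (0 : ℝ)..δ, f t) ≠ 0 := by
    by_contra hcon
    push Not at hcon
    have h1 := hI 0
    simp only [hcon] at h1
    have := h1.unique (hasDerivAt_const (0 : ℝ) (0 : ℂ))
    rw [h0] at this
    exact one_ne_zero this
  -- Integrating `f (x + t) = f x * f t` over `t` from 0 to `δ` expresses `f` through its primitive;
  -- this makes `f` differentiable.
  have hf : ∀ x, f x = ((∫ t in (0 : ℝ)..(x + δ), f t) - ∫ t in (0 : ℝ)..x, f t) /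
      ∫ t in (0 : ℝ)..δ, f t := by
    intro x
    rw [eq_div_iff hδ, intervalIntegral.integral_interval_sub_left (hc.intervalIntegrable _ _)
      (hc.intervalIntegrable _ _), ← intervalIntegral.integral_const_mul]
    simp only [← hadd]
    rw [intervalIntegral.integral_comp_add_left (f := f), add_zero]
  have hd0 : DifferentiableAt ℝ f 0 := by
    rw [show f = _ from funext hf]
    refine DifferentiableAt.div_const (DifferentiableAt.sub ?_ (hI 0).differentiableAt) _
    exact ((hI (0 + δ)).comp_add_const 0 δ).differentiableAt
  obtain ⟨c, hc0⟩ : ∃ c, HasDerivAt f c 0 := ⟨_, hd0.hasDerivAt⟩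
  have hd : ∀ x, HasDerivAt f (f x * c) x := by
    intro x
    have h1 : HasDerivAt (fun h => f x * f (h - x)) (f x * c) x := by
      have h2 : HasDerivAt f c (x - x) := by rwa [sub_self]
      exact (h2.comp_sub_const x x).const_mul (f x)
    convert h1 using 1
    ext h
    rw [← hadd, add_sub_cancel]
  have hexp : ∀ x : ℝ, HasDerivAt (fun x : ℝ => Complex.exp (-(c * x)))
      (Complex.exp (-(c * x)) * -c) x := by
    intro x
    have h1 : HasDerivAt (fun x : ℝ => -(c * (x : ℂ))) (-c) x := by
      have h2 := ((Complex.ofRealCLM.hasDerivAt (x := x)).const_mul c).neg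
      rw [Complex.ofRealCLM_apply, Complex.ofReal_one, mul_one] at h2
      exact h2
    exact h1.cexp
  have hconst : ∀ x, f x * Complex.exp (-(c * x)) = 1 := by
    intro x
    have h1 : ∀ x, HasDerivAt (fun x : ℝ => f x * Complex.exp (-(c * x))) 0 x := by
      intro x
      have h2 := (hd x).mul (hexp x)
      rwa [show f x * c * Complex.exp (-(c * x)) + f x * (Complex.exp (-(c * x)) * -c) = 0 by ring]
        at h2
    have h2 := is_const_of_deriv_eq_zero (fun x => (h1 x).differentiableAt)
      (fun x => (h1 x).deriv) x 0
    simpa [h0] using h2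
  have hfc : ∀ x : ℝ, f x = Complex.exp (c * x) := by
    intro x
    have h1 := hconst x
    rw [Complex.exp_neg] at h1
    exact eq_of_mul_inv_eq_one h1
  have hre : c.re = 0 := by
    have h1 := hnorm 1
    rw [hfc, Complex.norm_exp] at h1
    simpa using h1
  refine ⟨c.im, fun x => ?_⟩
  rw [hfc]
  congr 1
  apply Complex.ext <;> simp [hre]

/-! ### Coordinates on T and definable homomorphisms from T to SO₂ -/

theorem Sum.elim_eq_elim_iff {α β γ : Type*} {f f' : α → γ} {g g' : β → γ} :
    Sum.elim f g = Sum.elim f' g' ↔ f = f' ∧ g = g' := by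
  simp [funext_iff]

theorem RDefinable.sumElim_mem {ι κ μ : Type} [Finite κ] [Finite μ] {D : Set (κ ⊕ μ → ℝ)}
    (hD : RDefinable D) {F : (ι → ℝ) → κ → ℝ} {G : (ι → ℝ) → μ → ℝ}
    (hF : ∀ k, RFun fun v => F v k) (hG : ∀ k, RFun fun v => G v k) :
    RDefinable {v | Sum.elim (F v) (G v) ∈ D} :=
  hD.preimage (F := fun v => Sum.elim (F v) (G v)) (by rintro (k | k) <;> simp [hF, hG])

/-- The class of a real number in `T`. -/
noncomputable def Torus.of (x : ℝ) : Torus := Multiplicative.ofAdd (x : AddCircle (1 : ℝ))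

theorem Torus.of_add (x y : ℝ) : Torus.of (x + y) = Torus.of x * Torus.of y := rfl

theorem Torus.of_zero : Torus.of 0 = 1 := rfl

theorem Torus.of_one : Torus.of 1 = 1 := by
  have : ((1 : ℝ) : AddCircle (1 : ℝ)) = 0 := AddCircle.coe_period 1
  rw [Torus.of, this]
  rfl

theorem Torus.half_eq : Torus.half = Torus.of (1 / 2) := rfl

theorem Torus.continuous_of : Continuous Torus.of :=
  continuous_ofAdd.comp (AddCircle.continuous_mk' 1)

theorem Torus.coord_of {x : ℝ} (hx : x ∈ Ico (0 : ℝ) 1) : Torus.coord (Torus.of x) = fun _ => x := by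
  have hx' : x ∈ Ico (0 : ℝ) (0 + 1) := by rwa [zero_add]
  funext i
  simp only [Torus.coord, Torus.of, toAdd_ofAdd]
  rw [AddCircle.equivIco_coe_eq hx']

theorem Torus.coord_mem (t : Torus) : Torus.coord t 0 ∈ Ico (0 : ℝ) 1 := by
  have := (AddCircle.equivIco (1 : ℝ) 0 (Multiplicative.toAdd t)).2
  exact ⟨this.1, this.2.trans_eq (zero_add 1)⟩

theorem Torus.of_coord (t : Torus) : Torus.of (Torus.coord t 0) = t := by
  simp only [Torus.coord, Torus.of, AddCircle.coe_equivIco, ofAdd_toAdd]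

theorem Torus.coord_injective : Function.Injective Torus.coord := fun s t h => by
  rw [← Torus.of_coord s, h, Torus.of_coord]

theorem Torus.mem_range_coord {v : Fin 1 → ℝ} : v ∈ range Torus.coord ↔ 0 ≤ v 0 ∧ v 0 < 1 := by
  constructor
  · rintro ⟨t, rfl⟩
    exact Torus.coord_mem t
  · intro h
    refine ⟨Torus.of (v 0), ?_⟩
    rw [Torus.coord_of h]
    funext i
    rw [Subsingleton.elim i 0]

/-- A bounded definable curve in the plane satisfies the alternative required by
`exists_tendsto_of_eventually_or`. -/
theorem RDefinable.eventually_circle_or {D : Set (Fin 1 ⊕ Fin 2 → ℝ)} (hD : RDefinable D)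
    {f : ℝ → Circle} {l : Filter ℝ} (hl : ∀ p : ℝ[X], ∃ s, ∀ᶠ t in l, sign (p.eval t) = s)
    (hf : ∀ᶠ t in l, ∀ u, Sum.elim (fun _ => t) u ∈ D ↔ u = SO2.coord (f t)) (z : Circle)
    (U : Set Circle) (hU : U ∈ 𝓝 z) :
    ∃ V ∈ 𝓝 z, V ⊆ U ∧ ((∀ᶠ t in l, f t ∈ V) ∨ ∀ᶠ t in l, f t ∉ V) := by
  obtain ⟨ε, hε, hball⟩ := Metric.mem_nhds_iff.1 hU
  refine ⟨_, Metric.ball_mem_nhds z hε, hball, ?_⟩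
  have hS : RDefinable {v : Fin 1 → ℝ | ∃ u : Fin 2 → ℝ, Sum.elim v u ∈ D ∧
      (u 0 - (z : ℂ).re) ^ 2 + (u 1 - (z : ℂ).im) ^ 2 < ε ^ 2} :=
    RDefinable.exists ((hD.sumElim_mem (by fun_prop) (by fun_prop)).and
      (RDefinable.lt (by fun_prop) (by fun_prop)))
  have key : ∀ᶠ t in l, ((fun _ => t) ∈ {v : Fin 1 → ℝ | ∃ u : Fin 2 → ℝ, Sum.elim v u ∈ D ∧
      (u 0 - (z : ℂ).re) ^ 2 + (u 1 - (z : ℂ).im) ^ 2 < ε ^ 2} ↔ f t ∈ Metric.ball z ε) := by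
    refine hf.mono fun t ht => ?_
    simp only [mem_ofPred_eq, ht, exists_eq_left, SO2.coord, Matrix.cons_val_zero,
      Matrix.cons_val_one, Metric.mem_ball]
    change _ ↔ dist (f t : ℂ) (z : ℂ) < ε
    rw [Complex.dist_eq, ← sq_lt_sq₀ (norm_nonneg _) hε.le, Complex.sq_norm, Complex.normSq_apply]
    simp [sq]
  rcases hS.semialgebraic.eventually_or hl with h | h
  · exact Or.inl ((h.and key).mono fun t ht => ht.2.1 ht.1)
  · exact Or.inr ((h.and key).mono fun t ht => fun h' => ht.1 (ht.2.2 h'))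

/-- Inversion turns the right limit at 0 into the left one, and translation carries continuity at 0
to every point. -/
theorem continuous_of_tendsto_nhdsGT {f : ℝ → Circle} (hadd : ∀ x y, f (x + y) = f x * f y)
    (h : Tendsto f (𝓝[>] 0) (𝓝 1)) : Continuous f := by
  have h0 : f 0 = 1 := by
    have := hadd 0 0
    rwa [add_zero, left_eq_mul] at this
  have hneg : ∀ x, f (-x) = (f x)⁻¹ := fun x => by
    rw [eq_inv_iff_mul_eq_one, ← hadd, neg_add_cancel, h0]
  have hc : ContinuousAt f 0 := by
    rw [continuousAt_iff_continuous_left'_right']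
    refine ⟨?_, by rwa [ContinuousWithinAt, h0]⟩
    rw [ContinuousWithinAt, h0]
    have ht : Tendsto (fun t : ℝ => -t) (𝓝[<] 0) (𝓝[>] 0) := by
      refine tendsto_nhdsWithin_of_tendsto_nhds_of_eventually_within _ ?_ ?_
      · exact (tendsto_nhds_of_tendsto_nhdsWithin (s := univ)
          (by simpa using (continuous_neg.tendsto (0 : ℝ)))).mono_left nhdsWithin_le_nhds
      · filter_upwards [self_mem_nhdsWithin] with t ht
        exact neg_pos.2 (show t < 0 from ht)
    have := (h.comp ht).inv
    simpa [Function.comp_def, hneg] using this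
  refine continuous_iff_continuousAt.2 fun x => ?_
  have h1 : f = fun y => f x * f (y - x) := by
    funext y
    rw [← hadd, add_sub_cancel]
  rw [h1]
  have h2 : ContinuousAt f (x - x) := by rwa [sub_self]
  exact continuousAt_const.mul (h2.comp (f := fun y => y - x) (by fun_prop))

/-- Every definable homomorphism from `T` to `SO₂` is trivial. -/
theorem Torus.hom_eq_one_of_definable (φ : Torus →* Circle)
    (hφ : DefinableFunOn Torus.coord SO2.coord φ Set.univ) : φ = 1 := by
  set D := {v : Fin 1 ⊕ Fin 2 → ℝ | ∃ x ∈ (Set.univ : Set Torus),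
    v = Sum.elim (Torus.coord x) (SO2.coord (φ x))} with hDdef
  have hD : RDefinable D := hφ
  let f : ℝ → Circle := fun x => φ (Torus.of x)
  have hadd : ∀ x y, f (x + y) = f x * f y := fun x y => by
    simp only [f, Torus.of_add, map_mul]
  have hDf : ∀ t ∈ Ico (0 : ℝ) 1, ∀ u, Sum.elim (fun _ => t) u ∈ D ↔ u = SO2.coord (f t) := by
    intro t ht u
    constructor
    · rintro ⟨x, -, hx⟩
      obtain ⟨h1, h2⟩ := Sum.elim_eq_elim_iff.1 hx
      rw [h2, ← Torus.of_coord x, ← h1]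
    · rintro rfl
      exact ⟨Torus.of t, mem_univ _, by rw [Torus.coord_of ht]⟩
  have hDf' : ∀ᶠ t in 𝓝[>] (0 : ℝ), ∀ u, Sum.elim (fun _ => t) u ∈ D ↔ u = SO2.coord (f t) := by
    filter_upwards [Ioo_mem_nhdsGT (show (0 : ℝ) < 1 by norm_num)] with t ht
    exact hDf t ⟨ht.1.le, ht.2⟩
  obtain ⟨L, hL⟩ := exists_tendsto_of_eventually_or
    (hD.eventually_circle_or (fun p => p.eventually_sign_nhdsGT 0) hDf')
  -- Doubling `t` preserves the right neighbourhoods of 0, so `L * L = L`.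
  have hL1 : L = 1 := by
    have ht : Tendsto (fun t : ℝ => t + t) (𝓝[>] 0) (𝓝[>] 0) := by
      refine tendsto_nhdsWithin_of_tendsto_nhds_of_eventually_within _ ?_ ?_
      · have : Tendsto (fun t : ℝ => t + t) (𝓝 0) (𝓝 (0 + 0)) :=
          (continuous_id.add continuous_id).tendsto 0
        rw [add_zero] at this
        exact this.mono_left nhdsWithin_le_nhds
      · filter_upwards [self_mem_nhdsWithin] with t ht
        exact add_pos (show 0 < t from ht) ht
    have h1 := hL.comp ht
    simp only [Function.comp_def, hadd] at h1
    exact mul_eq_left.1 (tendsto_nhds_unique (hL.mul hL) h1)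
  have hcont := continuous_of_tendsto_nhdsGT hadd (hL1 ▸ hL)
  obtain ⟨k, hk⟩ := exists_re_eq_cos_of_continuous (f := fun x => (f x : ℂ))
    (by fun_prop) (fun x y => by rw [hadd, Circle.coe_mul])
    (fun x => Circle.norm_coe _)
  have hk0 : k = 0 := by
    by_contra hk0
    -- The first coordinate of `f` is `cos (k t)`, so its graph over (0,1) inherits definability.
    have hgraph : RDefinable {v : Fin 2 → ℝ | v 0 ∈ Ioo (0 : ℝ) 1 ∧ v 1 = Real.cos (k * v 0)} := by
      have : RDefinable {v : Fin 2 → ℝ | (0 < v 0 ∧ v 0 < 1) ∧ ∃ u : Fin 2 → ℝ,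
          Sum.elim (fun _ => v 0) u ∈ D ∧ v 1 = u 0} :=
        ((RDefinable.lt (by fun_prop) (by fun_prop)).and
          (RDefinable.lt (by fun_prop) (by fun_prop))).and
          (RDefinable.exists ((hD.sumElim_mem (by fun_prop) (by fun_prop)).and
            (RDefinable.eq (by fun_prop) (by fun_prop))))
      convert this using 1
      ext v
      refine and_congr_right fun hv => ?_
      have hre : SO2.coord (f (v 0)) 0 = Real.cos (k * v 0) := by
        have := congrArg Complex.re (hk (v 0))
        rw [← Complex.ofReal_mul, Complex.exp_ofReal_mul_I_re] at this
        exact this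
      simp only [hDf (v 0) ⟨hv.1.le, hv.2⟩, exists_eq_left, hre]
    obtain ⟨Q, hQ0, hQ⟩ := hgraph.semialgebraic.exists_polynomial_of_graph
      (f := fun t => Real.cos (k * t))
    exact hQ0 (eq_zero_of_eval_cos_eq_zero hk0 Q hQ)
  refine MonoidHom.ext fun t => Circle.ext ?_
  have := hk (Torus.coord t 0)
  simp only [f, Torus.of_coord] at this
  simp [this, hk0]

/-! ### Definability of the product and of small balls in T × SU₂ -/

/-- The unit quaternion with given coefficients. -/
def SU2.mk (v : Fin 4 → ℝ) (h : v 0 ^ 2 + v 1 ^ 2 + v 2 ^ 2 + v 3 ^ 2 = 1) : SU2 :=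
  ⟨⟨v 0, v 1, v 2, v 3⟩, (SU2.mem_iff _).2 h⟩

theorem SU2.coord_mk (v : Fin 4 → ℝ) (h : v 0 ^ 2 + v 1 ^ 2 + v 2 ^ 2 + v 3 ^ 2 = 1) :
    SU2.coord (SU2.mk v h) = v := by
  funext i
  fin_cases i <;> rfl

theorem SU2.coord_injective : Function.Injective SU2.coord := fun p q h => by
  refine Subtype.ext (Quaternion.ext _ _ ?_ ?_ ?_ ?_)
  · exact congrFun h 0
  · exact congrFun h 1
  · exact congrFun h 2
  · exact congrFun h 3

theorem SU2.coord_sq (q : SU2) : SU2.coord q 0 ^ 2 + SU2.coord q 1 ^ 2 + SU2.coord q 2 ^ 2 +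
    SU2.coord q 3 ^ 2 = 1 := (SU2.mem_iff _).1 q.2

theorem SU2.mem_range_coord {v : Fin 4 → ℝ} :
    v ∈ range SU2.coord ↔ v 0 ^ 2 + v 1 ^ 2 + v 2 ^ 2 + v 3 ^ 2 = 1 :=
  ⟨fun ⟨q, hq⟩ => hq ▸ SU2.coord_sq q, fun h => ⟨SU2.mk v h, SU2.coord_mk v h⟩⟩

/-- The quaternion product in coordinates. -/
def quatMul (a b : Fin 4 → ℝ) : Fin 4 → ℝ :=
  ![a 0 * b 0 - a 1 * b 1 - a 2 * b 2 - a 3 * b 3, a 0 * b 1 + a 1 * b 0 + a 2 * b 3 - a 3 * b 2,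
    a 0 * b 2 - a 1 * b 3 + a 2 * b 0 + a 3 * b 1, a 0 * b 3 + a 1 * b 2 - a 2 * b 1 + a 3 * b 0]

theorem SU2.coord_mul (p q : SU2) : SU2.coord (p * q) = quatMul (SU2.coord p) (SU2.coord q) := by
  funext i
  fin_cases i <;> simp [SU2.coord, quatMul]

theorem SU2.coord_neg (p : SU2) : SU2.coord (-p) = -SU2.coord p := by
  funext i
  fin_cases i <;> rfl

theorem SU2.coord_one : SU2.coord 1 = ![1, 0, 0, 0] := by
  funext i
  fin_cases i <;> rfl

theorem Torus.of_sub_one (x : ℝ) : Torus.of (x - 1) = Torus.of x := by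
  conv_rhs => rw [← sub_add_cancel x 1, Torus.of_add, Torus.of_one, mul_one]

theorem Torus.coord_mul (s t : Torus) :
    Torus.coord (s * t) 0 = Torus.coord s 0 + Torus.coord t 0 ∨
      Torus.coord (s * t) 0 = Torus.coord s 0 + Torus.coord t 0 - 1 := by
  have hs := Torus.coord_mem s
  have ht := Torus.coord_mem t
  have e : s * t = Torus.of (Torus.coord s 0 + Torus.coord t 0) := by
    rw [Torus.of_add, Torus.of_coord, Torus.of_coord]
  rcases lt_or_ge (Torus.coord s 0 + Torus.coord t 0) 1 with h | h
  · left
    conv_lhs => rw [e]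
    rw [Torus.coord_of ⟨add_nonneg hs.1 ht.1, h⟩]
  · right
    conv_lhs => rw [e, ← Torus.of_sub_one]
    rw [Torus.coord_of ⟨by linarith, by linarith [hs.2, ht.2]⟩]

theorem TorusSU2.coord_injective : Function.Injective TorusSU2.coord := fun p q h => by
  obtain ⟨h1, h2⟩ := Sum.elim_eq_elim_iff.1 h
  exact Prod.ext (Torus.coord_injective h1) (SU2.coord_injective h2)

theorem TorusSU2.mem_range_coord {v : Fin 1 ⊕ Fin 4 → ℝ} : v ∈ range TorusSU2.coord ↔
    (0 ≤ v (Sum.inl 0) ∧ v (Sum.inl 0) < 1) ∧ v (Sum.inr 0) ^ 2 + v (Sum.inr 1) ^ 2 +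
      v (Sum.inr 2) ^ 2 + v (Sum.inr 3) ^ 2 = 1 := by
  constructor
  · rintro ⟨p, rfl⟩
    exact ⟨Torus.coord_mem p.1, SU2.coord_sq p.2⟩
  · rintro ⟨h1, h2⟩
    obtain ⟨t, ht⟩ := (Torus.mem_range_coord (v := fun i => v (Sum.inl i))).2 h1
    obtain ⟨q, hq⟩ := (SU2.mem_range_coord (v := fun i => v (Sum.inr i))).2 h2
    refine ⟨(t, q), ?_⟩
    rw [TorusSU2.coord, ht, hq]
    exact Sum.elim_comp_inl_inr v

theorem RDefinable.mem_range_coord {ι : Type} {F : (ι → ℝ) → Fin 1 ⊕ Fin 4 → ℝ}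
    (hF : ∀ k, RFun fun v => F v k) : RDefinable {v | F v ∈ range TorusSU2.coord} := by
  simp only [TorusSU2.mem_range_coord]
  have h0 := hF (Sum.inl 0)
  have h1 := fun k => hF (Sum.inr k)
  have h2 := h1 0
  have h3 := h1 1
  have h4 := h1 2
  have h5 := h1 3
  exact ((RDefinable.le (by fun_prop) (by fun_prop)).and
    (RDefinable.lt (by fun_prop) (by fun_prop))).and (RDefinable.eq (by fun_prop) (by fun_prop))

/-- The graph of the product of `T × SU₂`. -/
def TorusSU2.mulGraph :
    Set (((Fin 1 ⊕ Fin 4) ⊕ (Fin 1 ⊕ Fin 4)) ⊕ (Fin 1 ⊕ Fin 4) → ℝ) :=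
  {w | ∃ p q, w = Sum.elim (Sum.elim (TorusSU2.coord p) (TorusSU2.coord q))
    (TorusSU2.coord (p * q))}

/-- The quaternion part is polynomial. For the T part a disjunction with and without wraparound
suffices, because membership in `[0,1)` allows only the correct alternative. -/
theorem TorusSU2.definable_mulGraph : RDefinable TorusSU2.mulGraph := by
  have h : RDefinable {w : ((Fin 1 ⊕ Fin 4) ⊕ (Fin 1 ⊕ Fin 4)) ⊕ (Fin 1 ⊕ Fin 4) → ℝ |
      (fun k => w (Sum.inl (Sum.inl k))) ∈ range TorusSU2.coord ∧
      (fun k => w (Sum.inl (Sum.inr k))) ∈ range TorusSU2.coord ∧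
      (fun k => w (Sum.inr k)) ∈ range TorusSU2.coord ∧
      (w (Sum.inr (Sum.inl 0)) = w (Sum.inl (Sum.inl (Sum.inl 0))) +
          w (Sum.inl (Sum.inr (Sum.inl 0))) ∨
        w (Sum.inr (Sum.inl 0)) = w (Sum.inl (Sum.inl (Sum.inl 0))) +
          w (Sum.inl (Sum.inr (Sum.inl 0))) - 1) ∧
      ∀ i, w (Sum.inr (Sum.inr i)) = quatMul (fun k => w (Sum.inl (Sum.inl (Sum.inr k))))
        (fun k => w (Sum.inl (Sum.inr (Sum.inr k)))) i} := by
    refine (RDefinable.mem_range_coord (by fun_prop)).and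
      ((RDefinable.mem_range_coord (by fun_prop)).and
      ((RDefinable.mem_range_coord (by fun_prop)).and
      (((RDefinable.eq (by fun_prop) (by fun_prop)).or
        (RDefinable.eq (by fun_prop) (by fun_prop))).and
      (RDefinable.forall_fin fun i => ?_))))
    fin_cases i <;> exact RDefinable.eq (by fun_prop) (by simp [quatMul]; fun_prop)
  convert h using 1
  ext w
  constructor
  · rintro ⟨p, q, rfl⟩
    refine ⟨⟨p, rfl⟩, ⟨q, rfl⟩, ⟨p * q, rfl⟩, Torus.coord_mul p.1 q.1, fun i => ?_⟩
    exact congrFun (SU2.coord_mul p.2 q.2) i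
  · rintro ⟨⟨p, hp⟩, ⟨q, hq⟩, ⟨r, hr⟩, ht, hs⟩
    refine ⟨p, q, ?_⟩
    have hpt := congrFun hp (Sum.inl 0)
    have hqt := congrFun hq (Sum.inl 0)
    have hrt := congrFun hr (Sum.inl 0)
    simp only [TorusSU2.coord, Sum.elim_inl] at hpt hqt hrt
    have e : r = p * q := by
      refine Prod.ext ?_ (SU2.coord_injective ?_)
      · change r.1 = p.1 * q.1
        rw [← Torus.of_coord r.1, ← Torus.of_coord p.1, ← Torus.of_coord q.1, hrt, hpt, hqt,
          ← Torus.of_add]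
        rcases ht with ht | ht
        · rw [ht]
        · rw [ht, Torus.of_sub_one]
      · change SU2.coord r.2 = SU2.coord (p.2 * q.2)
        rw [SU2.coord_mul]
        funext i
        have h1 : ∀ i, SU2.coord p.2 i = w (Sum.inl (Sum.inl (Sum.inr i))) :=
          fun i => congrFun hp (Sum.inr i)
        have h2 : ∀ i, SU2.coord q.2 i = w (Sum.inl (Sum.inr (Sum.inr i))) :=
          fun i => congrFun hq (Sum.inr i)
        rw [show SU2.coord p.2 = _ from funext h1, show SU2.coord q.2 = _ from funext h2, ← hs]
        exact congrFun hr (Sum.inr i)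
    rw [← e, hp, hq, hr]
    funext k
    rcases k with (k | k) | k <;> rfl

theorem AddCircle.norm_coe_lt_iff {x ε : ℝ} :
    ‖(x : AddCircle (1 : ℝ))‖ < ε ↔ ∃ n : ℤ, |x - n| < ε := by
  rw [AddCircle.norm_eq]
  simp only [inv_one, one_mul, mul_one]
  exact ⟨fun h => ⟨_, h⟩, fun ⟨n, hn⟩ => (round_le x n).trans_lt hn⟩

/-- Representatives in `[0,1)` differ by less than 1, so with `ε ≤ 1` only the integers -1, 0, 1 can
bring the difference within `ε` of 0. This makes balls definable without quantifying over integers.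
-/
theorem Torus.dist_lt_iff {s t : Torus} {ε : ℝ} (hε : ε ≤ 1) : dist s t < ε ↔
    ∃ i : Fin 3, |Torus.coord s 0 - Torus.coord t 0 - (![-1, 0, 1] i : ℝ)| < ε := by
  have hs := Torus.coord_mem s
  have ht := Torus.coord_mem t
  have e : dist s t = ‖((Torus.coord s 0 - Torus.coord t 0 : ℝ) : AddCircle (1 : ℝ))‖ := by
    change dist (Multiplicative.toAdd s) (Multiplicative.toAdd t) = _
    rw [dist_eq_norm]
    congr 1
    rw [AddCircle.coe_sub]
    congr 1
    · exact (AddCircle.coe_equivIco (a := (0 : ℝ))).symm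
    · exact (AddCircle.coe_equivIco (a := (0 : ℝ))).symm
  rw [e, AddCircle.norm_coe_lt_iff]
  constructor
  · rintro ⟨n, hn⟩
    have h1 : (-2 : ℝ) < n := by
      rw [abs_lt] at hn; linarith [hs.1, ht.2]
    have h2 : (n : ℝ) < 2 := by
      rw [abs_lt] at hn; linarith [hs.2, ht.1]
    have h1' : -2 < n := by exact_mod_cast h1
    have h2' : n < 2 := by exact_mod_cast h2
    obtain rfl | rfl | rfl : n = -1 ∨ n = 0 ∨ n = 1 := by omega
    · exact ⟨0, by simpa using hn⟩
    · exact ⟨1, by simpa using hn⟩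
    · exact ⟨2, by simpa using hn⟩
  · rintro ⟨i, hi⟩
    fin_cases i
    · exact ⟨-1, by simpa using hi⟩
    · exact ⟨0, by simpa using hi⟩
    · exact ⟨1, by simpa using hi⟩

theorem SU2.dist_lt_iff {p q : SU2} {ε : ℝ} (hε : 0 < ε) : dist p q < ε ↔
    (SU2.coord p 0 - SU2.coord q 0) ^ 2 + (SU2.coord p 1 - SU2.coord q 1) ^ 2 +
      (SU2.coord p 2 - SU2.coord q 2) ^ 2 + (SU2.coord p 3 - SU2.coord q 3) ^ 2 < ε ^ 2 := by
  rw [Subtype.dist_eq, dist_eq_norm, ← sq_lt_sq₀ (norm_nonneg _) hε.le, sq ‖_‖,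
    ← Quaternion.normSq_eq_norm_mul_self, Quaternion.normSq_def']
  simp [SU2.coord]

theorem TorusSU2.definable_ball (p : Torus × SU2) {ε : ℝ} (hε : 0 < ε) (hε1 : ε ≤ 1) :
    DefinableSetIn TorusSU2.coord (Metric.ball p ε) := by
  -- The finite disjunction over shifts is written as a negated finite conjunction, and absolute
  -- values are replaced by squares.
  have h : RDefinable {v : Fin 1 ⊕ Fin 4 → ℝ | v ∈ range TorusSU2.coord ∧
      (¬ ∀ i : Fin 3, ¬ ((v (Sum.inl 0) - Torus.coord p.1 0 - (![-1, 0, 1] i : ℝ)) ^ 2 < ε ^ 2)) ∧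
      (v (Sum.inr 0) - SU2.coord p.2 0) ^ 2 + (v (Sum.inr 1) - SU2.coord p.2 1) ^ 2 +
      (v (Sum.inr 2) - SU2.coord p.2 2) ^ 2 + (v (Sum.inr 3) - SU2.coord p.2 3) ^ 2 < ε ^ 2} :=
    (RDefinable.mem_range_coord (by fun_prop)).and
      ((RDefinable.forall_fin fun i => (RDefinable.lt (by fun_prop) (by fun_prop)).not).not.and
        (RDefinable.lt (by fun_prop) (by fun_prop)))
  unfold DefinableSetIn
  convert h using 1
  ext v
  have key : ∀ q : Torus × SU2, q ∈ Metric.ball p ε ↔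
      (∃ i : Fin 3, (Torus.coord q.1 0 - Torus.coord p.1 0 - (![-1, 0, 1] i : ℝ)) ^ 2 < ε ^ 2) ∧
      (SU2.coord q.2 0 - SU2.coord p.2 0) ^ 2 + (SU2.coord q.2 1 - SU2.coord p.2 1) ^ 2 +
      (SU2.coord q.2 2 - SU2.coord p.2 2) ^ 2 + (SU2.coord q.2 3 - SU2.coord p.2 3) ^ 2
        < ε ^ 2 := by
    intro q
    rw [Metric.mem_ball, Prod.dist_eq, max_lt_iff, Torus.dist_lt_iff hε1, SU2.dist_lt_iff hε]
    simp only [sq_lt_sq, abs_of_pos hε]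
  simp only [mem_ofPred_eq, not_forall, not_not]
  constructor
  · rintro ⟨q, hq, rfl⟩
    exact ⟨⟨q, rfl⟩, (key q).1 hq⟩
  · rintro ⟨⟨q, rfl⟩, h2⟩
    exact ⟨q, (key q).2 h2, rfl⟩

/-! ### The quotient as a definable group, and its definable compactness -/

section Quotient

variable {n : ℕ} {c : GEx → Fin n → ℝ}

theorem mem_quotientGraph_iff {u : Fin 1 ⊕ Fin 4 → ℝ}
    {w : Fin n → ℝ} :
    Sum.elim u w ∈ {v : (Fin 1 ⊕ Fin 4) ⊕ Fin n → ℝ | ∃ x ∈ (Set.univ : Set (Torus × SU2)),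
      v = Sum.elim (TorusSU2.coord x) (c (QuotientGroup.mk x))} ↔
    ∃ p, u = TorusSU2.coord p ∧ w = c (QuotientGroup.mk p) := by
  simp only [mem_ofPred_eq, mem_univ, true_and, Sum.elim_eq_elim_iff]

theorem IsDefinableQuotient.definable_graph (hc : IsDefinableQuotient c) {ι : Type}
    {F : (ι → ℝ) → Fin 1 ⊕ Fin 4 → ℝ} {W : (ι → ℝ) → Fin n → ℝ}
    (hF : ∀ k, RFun fun v => F v k) (hW : ∀ k, RFun fun v => W v k) :
    RDefinable {v | ∃ p : Torus × SU2, F v = TorusSU2.coord p ∧ W v = c (QuotientGroup.mk p)} := by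
  have := RDefinable.sumElim_mem hc.2 hF hW
  simpa only [mem_quotientGraph_iff] using this

/-- The graph of the projection is definable by assumption, so images, and likewise preimages, are
projections of definable sets. This transfers definability for arbitrary `c`. -/
theorem IsDefinableQuotient.image (hc : IsDefinableQuotient c) {S : Set (Torus × SU2)}
    (hS : DefinableSetIn TorusSU2.coord S) :
    DefinableSetIn c ((QuotientGroup.mk : Torus × SU2 → GEx) '' S) := by
  have h : RDefinable {w : Fin n → ℝ | ∃ u : Fin 1 ⊕ Fin 4 → ℝ, u ∈ TorusSU2.coord '' S ∧
      ∃ p : Torus × SU2, u = TorusSU2.coord p ∧ w = c (QuotientGroup.mk p)} :=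
    RDefinable.exists ((RDefinable.preimage hS (by fun_prop)).and
      (hc.definable_graph (by fun_prop) (by fun_prop)))
  unfold DefinableSetIn
  convert h using 1
  ext w
  constructor
  · rintro ⟨_, ⟨p, hp, rfl⟩, rfl⟩
    exact ⟨_, ⟨p, hp, rfl⟩, p, rfl, rfl⟩
  · rintro ⟨_, ⟨p, hp, rfl⟩, q, hq, rfl⟩
    rw [← TorusSU2.coord_injective hq]
    exact ⟨_, ⟨p, hp, rfl⟩, rfl⟩

theorem IsDefinableQuotient.preimage (hc : IsDefinableQuotient c) {S : Set GEx}
    (hS : DefinableSetIn c S) :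
    DefinableSetIn TorusSU2.coord ((QuotientGroup.mk : Torus × SU2 → GEx) ⁻¹' S) := by
  have h : RDefinable {u : Fin 1 ⊕ Fin 4 → ℝ | ∃ w : Fin n → ℝ, w ∈ c '' S ∧
      ∃ p : Torus × SU2, u = TorusSU2.coord p ∧ w = c (QuotientGroup.mk p)} :=
    RDefinable.exists ((RDefinable.preimage hS (by fun_prop)).and
      (hc.definable_graph (by fun_prop) (by fun_prop)))
  unfold DefinableSetIn
  convert h using 1
  ext u
  constructor
  · rintro ⟨p, hp, rfl⟩
    exact ⟨_, ⟨_, hp, rfl⟩, p, rfl, rfl⟩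
  · rintro ⟨_, ⟨x, hx, rfl⟩, q, rfl, hq⟩
    refine ⟨q, ?_, rfl⟩
    rw [hc.1 hq] at hx
    exact hx

theorem TorusSU2.definable_univ : DefinableSetIn TorusSU2.coord univ := by
  unfold DefinableSetIn
  rw [image_univ]
  exact RDefinable.mem_range_coord (F := fun v => v) (by fun_prop)

theorem IsDefinableQuotient.isDefinableGroup (hc : IsDefinableQuotient c) :
    IsDefinableGroup c where
  injective := hc.1
  definable_carrier := by
    have := hc.image TorusSU2.definable_univ
    rwa [image_univ, QuotientGroup.mk_surjective.range_eq] at this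
  definable_mul := by
    have h : RDefinable {w : (Fin n ⊕ Fin n) ⊕ Fin n → ℝ |
        ∃ u : ((Fin 1 ⊕ Fin 4) ⊕ (Fin 1 ⊕ Fin 4)) ⊕ (Fin 1 ⊕ Fin 4) → ℝ, u ∈ TorusSU2.mulGraph ∧
        (∃ p : Torus × SU2, (fun k => u (Sum.inl (Sum.inl k))) = TorusSU2.coord p ∧
          (fun k => w (Sum.inl (Sum.inl k))) = c (QuotientGroup.mk p)) ∧
        (∃ p : Torus × SU2, (fun k => u (Sum.inl (Sum.inr k))) = TorusSU2.coord p ∧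
          (fun k => w (Sum.inl (Sum.inr k))) = c (QuotientGroup.mk p)) ∧
        (∃ p : Torus × SU2, (fun k => u (Sum.inr k)) = TorusSU2.coord p ∧
          (fun k => w (Sum.inr k)) = c (QuotientGroup.mk p))} :=
      RDefinable.exists ((RDefinable.preimage TorusSU2.definable_mulGraph (by fun_prop)).and
        ((hc.definable_graph (by fun_prop) (by fun_prop)).and
        ((hc.definable_graph (by fun_prop) (by fun_prop)).and
        (hc.definable_graph (by fun_prop) (by fun_prop)))))
    convert h using 1
    ext w
    constructor
    · rintro ⟨x, y, rfl⟩
      obtain ⟨p, rfl⟩ := QuotientGroup.mk_surjective x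
      obtain ⟨q, rfl⟩ := QuotientGroup.mk_surjective y
      exact ⟨_, ⟨p, q, rfl⟩, ⟨p, rfl, rfl⟩, ⟨q, rfl, rfl⟩, ⟨p * q, rfl, rfl⟩⟩
    · rintro ⟨_, ⟨p, q, rfl⟩, ⟨p', hp, hp'⟩, ⟨q', hq, hq'⟩, ⟨r, hr, hr'⟩⟩
      obtain rfl := TorusSU2.coord_injective hp
      obtain rfl := TorusSU2.coord_injective hq
      obtain rfl := TorusSU2.coord_injective hr
      refine ⟨QuotientGroup.mk p, QuotientGroup.mk q, ?_⟩
      rw [← QuotientGroup.mk_mul, ← hp', ← hq', ← hr']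
      funext k
      rcases k with (k | k) | k <;> rfl

instance SU2.compactSpace : CompactSpace SU2 := by
  refine isCompact_iff_compactSpace.1 (Metric.isCompact_of_isClosed_isBounded ?_ ?_)
  · have h : ((unitary (Quaternion ℝ) : Submonoid (Quaternion ℝ)) : Set (Quaternion ℝ)) =
        {q | q.re ^ 2 + q.imI ^ 2 + q.imJ ^ 2 + q.imK ^ 2 = 1} := ext fun q => SU2.mem_iff q
    rw [h]
    exact isClosed_eq ((((Quaternion.continuous_re.pow 2).add (Quaternion.continuous_imI.pow 2)).add
      (Quaternion.continuous_imJ.pow 2)).add (Quaternion.continuous_imK.pow 2)) continuous_const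
  · refine Metric.isBounded_closedBall (x := (0 : Quaternion ℝ)) (r := 1) |>.subset fun q hq => ?_
    have h := (SU2.mem_iff q).1 hq
    rw [← Quaternion.normSq_def', Quaternion.normSq_eq_norm_mul_self] at h
    rw [mem_closedBall_zero_iff]
    nlinarith [norm_nonneg q]

/-- The projection is open, so images of small balls are neighbourhoods; radius at most 1 keeps the
balls definable. -/
theorem IsDefinableQuotient.exists_definable_nhds (hc : IsDefinableQuotient c) (x : GEx)
    {U : Set GEx} (hU : U ∈ 𝓝 x) : ∃ V ∈ 𝓝 x, V ⊆ U ∧ DefinableSetIn c V := by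
  obtain ⟨p, rfl⟩ := QuotientGroup.mk_surjective x
  have hcont : ContinuousAt (QuotientGroup.mk : Torus × SU2 → GEx) p :=
    QuotientGroup.continuous_mk.continuousAt
  obtain ⟨ε, hε, hball⟩ := Metric.mem_nhds_iff.1 (hcont hU)
  have hε' : 0 < min ε 1 := lt_min hε one_pos
  refine ⟨_, QuotientGroup.isOpenMap_coe.image_mem_nhds (Metric.ball_mem_nhds p hε'), ?_,
    hc.image (TorusSU2.definable_ball p hε' (min_le_right _ _))⟩
  rw [image_subset_iff]
  exact (Metric.ball_subset_ball (min_le_left _ _)).trans hball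

/-- Ordinary compactness of G gives a cluster point at each end. The times spent in a definable
neighbourhood form a definable subset of the line, so the curve cannot enter and leave it forever.
-/
theorem IsDefinableQuotient.isDefinablyCompact (hc : IsDefinableQuotient c) :
    IsDefinablyCompact c := by
  intro a b γ hab _ hγ
  have key : ∀ l : Filter ℝ, l.NeBot → Ioo a b ∈ l →
      (∀ p : ℝ[X], ∃ s, ∀ᶠ t in l, sign (p.eval t) = s) → ∃ x, Tendsto γ l (𝓝 x) := by
    intro l hl hmem hsign
    refine exists_tendsto_of_eventually_or fun x U hU => ?_
    obtain ⟨V, hV, hVU, hVd⟩ := hc.exists_definable_nhds x hU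
    refine ⟨V, hV, hVU, ?_⟩
    have hS : RDefinable {v : Fin 1 → ℝ | ∃ w : Fin n → ℝ, Sum.elim v w ∈
        {v : Fin 1 ⊕ Fin n → ℝ | ∃ t ∈ Ioo a b, v = Sum.elim (fun _ => t) (c (γ t))} ∧
        w ∈ c '' V} :=
      RDefinable.exists ((RDefinable.sumElim_mem hγ (by fun_prop) (by fun_prop)).and
        (RDefinable.preimage hVd (by fun_prop)))
    have hiff : ∀ᶠ t in l, ((fun _ => t) ∈ {v : Fin 1 → ℝ | ∃ w : Fin n → ℝ, Sum.elim v w ∈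
        {v : Fin 1 ⊕ Fin n → ℝ | ∃ t ∈ Ioo a b, v = Sum.elim (fun _ => t) (c (γ t))} ∧
        w ∈ c '' V} ↔ γ t ∈ V) := by
      filter_upwards [hmem] with t ht
      constructor
      · rintro ⟨_, ⟨t', ht', e⟩, y, hy, rfl⟩
        obtain ⟨e1, e2⟩ := Sum.elim_eq_elim_iff.1 e
        rw [congrFun e1 0, ← hc.1 e2]
        exact hy
      · intro h
        exact ⟨c (γ t), ⟨t, ht, rfl⟩, γ t, h, rfl⟩
    rcases hS.semialgebraic.eventually_or hsign with h | h
    · exact Or.inl ((h.and hiff).mono fun t ht => ht.2.1 ht.1)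
    · exact Or.inr ((h.and hiff).mono fun t ht => fun h' => ht.1 (ht.2.2 h'))
  exact ⟨key _ inferInstance (Ioo_mem_nhdsGT hab) fun p => p.eventually_sign_nhdsGT a,
    key _ inferInstance (Ioo_mem_nhdsLT hab) fun p => p.eventually_sign_nhdsLT b⟩

end Quotient

/-! ### Charts and the definable atlas -/

theorem SU2.continuous_coord : Continuous SU2.coord := by
  refine continuous_pi fun i => ?_
  fin_cases i
  · exact Quaternion.continuous_re.comp continuous_subtype_val
  · exact Quaternion.continuous_imI.comp continuous_subtype_val
  · exact Quaternion.continuous_imJ.comp continuous_subtype_val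
  · exact Quaternion.continuous_imK.comp continuous_subtype_val

theorem SU2.continuous_of_coord {X : Type*} [TopologicalSpace X] {f : X → SU2}
    (h : Continuous fun x => SU2.coord (f x)) : Continuous f := by
  refine continuous_induced_rng.2 ?_
  exact Quaternion.linearIsometryEquivTuple.symm.continuous.comp
    ((PiLp.continuous_toLp 2 _).comp h)

theorem Torus.continuousAt_coord {t : Torus} (ht : t ≠ 1) : ContinuousAt Torus.coord t := by
  refine continuousAt_pi.2 fun _ => ?_
  have h : ContinuousAt (AddCircle.equivIco (1 : ℝ) 0) (Multiplicative.toAdd t) :=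
    AddCircle.continuousAt_equivIco 1 0 fun h => ht (Multiplicative.toAdd.injective h)
  exact continuous_subtype_val.continuousAt.comp (h.comp continuous_toAdd.continuousAt)

theorem Torus.coord_eq_zero_iff {t : Torus} : Torus.coord t 0 = 0 ↔ t = 1 := by
  constructor
  · intro h
    rw [← Torus.of_coord t, h, Torus.of_zero]
  · rintro rfl
    rw [← Torus.of_zero, Torus.coord_of ⟨le_rfl, one_pos⟩]

/-- The unit quaternion on the ray through `1 + v 1 i + v 2 j + v 3 k`. -/
noncomputable def SU2.ofAffine (v : Fin 4 → ℝ) : SU2 :=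
  SU2.mk ((√(1 + v 1 ^ 2 + v 2 ^ 2 + v 3 ^ 2))⁻¹ • ![1, v 1, v 2, v 3]) (by
    have h : 0 < 1 + v 1 ^ 2 + v 2 ^ 2 + v 3 ^ 2 := by positivity
    have h2 := Real.sq_sqrt h.le
    have h3 := (Real.sqrt_pos.2 h).ne'
    simp only [Pi.smul_apply, smul_eq_mul, Matrix.cons_val]
    field_simp
    linarith)

theorem SU2.coord_ofAffine (v : Fin 4 → ℝ) : SU2.coord (SU2.ofAffine v) =
    (√(1 + v 1 ^ 2 + v 2 ^ 2 + v 3 ^ 2))⁻¹ • ![1, v 1, v 2, v 3] := SU2.coord_mk _ _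

theorem SU2.continuous_ofAffine : Continuous SU2.ofAffine := by
  refine SU2.continuous_of_coord ?_
  simp only [SU2.coord_ofAffine]
  have hs : Continuous fun v : Fin 4 → ℝ => (√(1 + v 1 ^ 2 + v 2 ^ 2 + v 3 ^ 2))⁻¹ := by
    refine Continuous.inv₀ (by fun_prop) fun v => ?_
    have h : 0 < 1 + v 1 ^ 2 + v 2 ^ 2 + v 3 ^ 2 := by positivity
    exact (Real.sqrt_pos.2 h).ne'
  refine hs.smul (continuous_pi fun i => ?_)
  fin_cases i <;> simp <;> fun_prop

/-- A chart of `T × SU₂`. -/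
noncomputable def TorusSU2.chart : OpenPartialHomeomorph (Torus × SU2) (Fin 4 → ℝ) where
  toFun p := ![Torus.coord p.1 0, SU2.coord p.2 1 / SU2.coord p.2 0,
    SU2.coord p.2 2 / SU2.coord p.2 0, SU2.coord p.2 3 / SU2.coord p.2 0]
  invFun v := (Torus.of (v 0), SU2.ofAffine v)
  -- Removing `1` avoids the jump of `Torus.coord`. The open hemisphere admits central projection
  -- and contains at most one of `q`, `-q`.
  source := {p | p.1 ≠ 1 ∧ 0 < SU2.coord p.2 0}
  target := {v | v 0 ∈ Ioo 0 1}
  map_source' := by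
    rintro p ⟨h1, -⟩
    have h := Torus.coord_mem p.1
    exact ⟨lt_of_le_of_ne h.1 fun e => h1 (Torus.coord_eq_zero_iff.1 e.symm), h.2⟩
  map_target' := by
    rintro v ⟨h1, h2⟩
    refine ⟨fun e => h1.ne' ?_, ?_⟩
    · have := Torus.coord_eq_zero_iff.2 e
      rwa [Torus.coord_of ⟨h1.le, h2⟩] at this
    · have h : 0 < 1 + v 1 ^ 2 + v 2 ^ 2 + v 3 ^ 2 := by positivity
      simp [SU2.coord_ofAffine, h]
  left_inv' := by
    rintro p ⟨-, h2⟩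
    refine Prod.ext (Torus.of_coord p.1) (SU2.coord_injective ?_)
    have h := SU2.coord_sq p.2
    have e : 1 + (SU2.coord p.2 1 / SU2.coord p.2 0) ^ 2 + (SU2.coord p.2 2 / SU2.coord p.2 0) ^ 2 +
        (SU2.coord p.2 3 / SU2.coord p.2 0) ^ 2 = ((SU2.coord p.2 0)⁻¹) ^ 2 := by
      field_simp
      linarith
    rw [SU2.coord_ofAffine]
    simp only [Matrix.cons_val]
    rw [e, Real.sqrt_sq (inv_pos.2 h2).le, inv_inv]
    funext i
    fin_cases i <;> simp <;> field_simp
  right_inv' := by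
    rintro v ⟨h1, h2⟩
    have h : 0 < 1 + v 1 ^ 2 + v 2 ^ 2 + v 3 ^ 2 := by positivity
    have h3 := (Real.sqrt_pos.2 h).ne'
    funext i
    fin_cases i
    · simp [Torus.coord_of ⟨h1.le, h2⟩]
    all_goals simp [SU2.coord_ofAffine]; field_simp
  open_source := by
    refine IsOpen.inter ?_ ?_
    · exact isOpen_ne.preimage continuous_fst
    · exact isOpen_lt continuous_const
        ((continuous_apply 0).comp (SU2.continuous_coord.comp continuous_snd))
  open_target := isOpen_Ioo.preimage (continuous_apply 0)
  continuousOn_toFun := by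
    rintro p ⟨h1, h2⟩
    refine ContinuousAt.continuousWithinAt (continuousAt_pi.2 fun i => ?_)
    have hq : ∀ i, ContinuousAt (fun p : Torus × SU2 => SU2.coord p.2 i) p := fun i =>
      ((continuous_apply i).comp (SU2.continuous_coord.comp continuous_snd)).continuousAt
    have ht : ContinuousAt (fun p : Torus × SU2 => Torus.coord p.1 0) p :=
      (continuousAt_pi.1 (Torus.continuousAt_coord h1) 0).comp continuous_fst.continuousAt
    fin_cases i
    · exact ht
    · exact (hq 1).div (hq 0) h2.ne'
    · exact (hq 2).div (hq 0) h2.ne'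
    · exact (hq 3).div (hq 0) h2.ne'
  continuousOn_invFun := ((Torus.continuous_of.comp (continuous_apply 0)).prodMk
    SU2.continuous_ofAffine).continuousOn

theorem GEx.mk_eq_mk_iff {p q : Torus × SU2} : (QuotientGroup.mk p : GEx) = QuotientGroup.mk q ↔
    q = p ∨ q = (p.1 * Torus.half, -p.2) := by
  rw [QuotientGroup.eq]
  change p⁻¹ * q = (1, 1) ∨ p⁻¹ * q = (Torus.half, -1) ↔ _
  rw [inv_mul_eq_iff_eq_mul, inv_mul_eq_iff_eq_mul]
  simp [Prod.ext_iff]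

/-- The nontrivial element of Γ negates the quaternion and so leaves the hemisphere. -/
theorem GEx.injOn_mk : InjOn (QuotientGroup.mk : Torus × SU2 → GEx) TorusSU2.chart.source := by
  rintro p ⟨-, hp⟩ q ⟨-, hq⟩ h
  rcases GEx.mk_eq_mk_iff.1 h with h | h
  · exact h.symm
  · rw [h, SU2.coord_neg, Pi.neg_apply] at hq
    linarith

/-- The projection to `G`, restricted to the domain of the chart. -/
noncomputable def GEx.proj : OpenPartialHomeomorph (Torus × SU2) GEx :=
  OpenPartialHomeomorph.ofContinuousOpen
    (BijOn.toPartialEquiv QuotientGroup.mk TorusSU2.chart.source _ GEx.injOn_mk.bijOn_image)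
    QuotientGroup.continuous_mk.continuousOn QuotientGroup.isOpenMap_coe
    TorusSU2.chart.open_source

/-- A chart of `G`. -/
noncomputable def GEx.chart : OpenPartialHomeomorph GEx (Fin 4 → ℝ) :=
  GEx.proj.symm.trans TorusSU2.chart

theorem GEx.proj_symm_mk {p : Torus × SU2} (hp : p ∈ TorusSU2.chart.source) :
    GEx.proj.symm (QuotientGroup.mk p) = p := GEx.proj.left_inv hp

theorem GEx.chart_source :
    GEx.chart.source = (QuotientGroup.mk : Torus × SU2 → GEx) '' TorusSU2.chart.source := by
  rw [GEx.chart, OpenPartialHomeomorph.trans_source]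
  refine Subset.antisymm inter_subset_left ?_
  rintro _ ⟨p, hp, rfl⟩
  refine ⟨⟨p, hp, rfl⟩, ?_⟩
  rw [mem_preimage, GEx.proj_symm_mk hp]
  exact hp

theorem GEx.chart_mk {p : Torus × SU2} (hp : p ∈ TorusSU2.chart.source) :
    GEx.chart (QuotientGroup.mk p) = TorusSU2.chart p := by
  rw [GEx.chart, OpenPartialHomeomorph.trans_apply, GEx.proj_symm_mk hp]

/-- The translate of the chart by a group element. -/
noncomputable def GEx.chartAt (g : Torus × SU2) : OpenPartialHomeomorph GEx (Fin 4 → ℝ) :=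
  (Homeomorph.mulLeft (QuotientGroup.mk g : GEx)).transOpenPartialHomeomorph GEx.chart

theorem GEx.mem_chartAt_source {g : Torus × SU2} {x : GEx} : x ∈ (GEx.chartAt g).source ↔
    ∃ p ∈ TorusSU2.chart.source, x = QuotientGroup.mk (g⁻¹ * p) := by
  change QuotientGroup.mk g * x ∈ GEx.chart.source ↔ _
  rw [GEx.chart_source]
  refine exists_congr fun p => and_congr_right fun _ => ?_
  rw [QuotientGroup.mk_mul, QuotientGroup.mk_inv, eq_inv_mul_iff_mul_eq, eq_comm]

theorem GEx.chartAt_mk {g p : Torus × SU2} (hp : p ∈ TorusSU2.chart.source) :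
    GEx.chartAt g (QuotientGroup.mk (g⁻¹ * p)) = TorusSU2.chart p := by
  change GEx.chart (QuotientGroup.mk g * QuotientGroup.mk (g⁻¹ * p)) = _
  rw [← QuotientGroup.mk_mul, mul_inv_cancel_left, GEx.chart_mk hp]

/-- Translates of a nonempty open set cover a group, and compactness selects finitely many. -/
theorem GEx.exists_finite_chartAt_cover :
    ∃ (m : ℕ) (g : Fin m → Torus × SU2), ∀ x, ∃ i, x ∈ (GEx.chartAt (g i)).source := by
  obtain ⟨p₀, hp₀⟩ : TorusSU2.chart.source.Nonempty := by
    refine ⟨TorusSU2.chart.symm fun _ => 1 / 2, TorusSU2.chart.map_target ?_⟩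
    exact ⟨by norm_num, by norm_num⟩
  have hcov : ∀ x : GEx, ∃ g, x ∈ (GEx.chartAt g).source := by
    intro x
    obtain ⟨q, rfl⟩ := QuotientGroup.mk_surjective x
    exact ⟨p₀ * q⁻¹, GEx.mem_chartAt_source.2 ⟨p₀, hp₀, by group⟩⟩
  choose g hg using hcov
  obtain ⟨s, hs⟩ := CompactSpace.elim_nhds_subcover (fun x => (GEx.chartAt (g x)).source)
    fun x => (GEx.chartAt (g x)).open_source.mem_nhds (hg x)
  refine ⟨s.card, fun i => g (s.equivFin.symm i), fun x => ?_⟩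
  obtain ⟨y, hy, hxy⟩ := mem_iUnion₂.1 (hs ▸ mem_univ x : x ∈ ⋃ x ∈ s, (GEx.chartAt (g x)).source)
  exact ⟨s.equivFin ⟨y, hy⟩, by simpa using hxy⟩

theorem TorusSU2.definable_chart_source :
    DefinableSetIn TorusSU2.coord TorusSU2.chart.source := by
  have h : RDefinable {v : Fin 1 ⊕ Fin 4 → ℝ | v ∈ range TorusSU2.coord ∧
      (¬ v (Sum.inl 0) = 0) ∧ 0 < v (Sum.inr 0)} :=
    (RDefinable.mem_range_coord (by fun_prop)).and ((RDefinable.eq (by fun_prop) (by fun_prop)).not.and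
      (RDefinable.lt (by fun_prop) (by fun_prop)))
  unfold DefinableSetIn
  convert h using 1
  ext v
  have key : ∀ p : Torus × SU2, p ∈ TorusSU2.chart.source ↔
      (¬ Torus.coord p.1 0 = 0) ∧ 0 < SU2.coord p.2 0 := fun p => by
    rw [Torus.coord_eq_zero_iff]
    rfl
  constructor
  · rintro ⟨p, hp, rfl⟩
    exact ⟨⟨p, rfl⟩, (key p).1 hp⟩
  · rintro ⟨⟨p, rfl⟩, h2⟩
    exact ⟨p, (key p).2 h2, rfl⟩

/-- Clearing denominators turns the chart into polynomial equations. -/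
theorem TorusSU2.chart_eq_iff {p : Torus × SU2} (hp : p ∈ TorusSU2.chart.source) {z : Fin 4 → ℝ} :
    z = TorusSU2.chart p ↔ z 0 = Torus.coord p.1 0 ∧
      z 1 * SU2.coord p.2 0 = SU2.coord p.2 1 ∧ z 2 * SU2.coord p.2 0 = SU2.coord p.2 2 ∧
      z 3 * SU2.coord p.2 0 = SU2.coord p.2 3 := by
  have h0 : SU2.coord p.2 0 ≠ 0 := hp.2.ne'
  rw [← eq_div_iff h0, ← eq_div_iff h0, ← eq_div_iff h0]
  constructor
  · rintro rfl
    exact ⟨rfl, rfl, rfl, rfl⟩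
  · rintro ⟨h1, h2, h3, h4⟩
    funext i
    fin_cases i
    · exact h1
    · exact h2
    · exact h3
    · exact h4

/-- Points of the translated domain are classes of `g⁻¹ * p` with `p` in the basic chart, so the
graph is a projection built from the product graph with first factor fixed at `g⁻¹`. -/
theorem IsDefinableQuotient.definable_chartAt {n : ℕ} {c : GEx → Fin n → ℝ}
    (hc : IsDefinableQuotient c) (g : Torus × SU2) :
    DefinableFunOn c id (GEx.chartAt g) (GEx.chartAt g).source := by
  have h : RDefinable {v : Fin n ⊕ Fin 4 → ℝ |
      ∃ u : ((Fin 1 ⊕ Fin 4) ⊕ (Fin 1 ⊕ Fin 4)) ⊕ (Fin 1 ⊕ Fin 4) → ℝ, u ∈ TorusSU2.mulGraph ∧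
        (fun k => u (Sum.inl (Sum.inl k))) ∈ {a : Fin 1 ⊕ Fin 4 → ℝ |
          a (Sum.inl 0) = Torus.coord g⁻¹.1 0 ∧ ∀ i, a (Sum.inr i) = SU2.coord g⁻¹.2 i} ∧
        (fun k => u (Sum.inl (Sum.inr k))) ∈ TorusSU2.coord '' TorusSU2.chart.source ∧
        (∃ p : Torus × SU2, (fun k => u (Sum.inr k)) = TorusSU2.coord p ∧
          (fun k => v (Sum.inl k)) = c (QuotientGroup.mk p)) ∧
        (v (Sum.inr 0) = u (Sum.inl (Sum.inr (Sum.inl 0))) ∧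
          v (Sum.inr 1) * u (Sum.inl (Sum.inr (Sum.inr 0))) = u (Sum.inl (Sum.inr (Sum.inr 1))) ∧
          v (Sum.inr 2) * u (Sum.inl (Sum.inr (Sum.inr 0))) = u (Sum.inl (Sum.inr (Sum.inr 2))) ∧
          v (Sum.inr 3) * u (Sum.inl (Sum.inr (Sum.inr 0))) =
            u (Sum.inl (Sum.inr (Sum.inr 3))))} := by
    refine RDefinable.exists ((RDefinable.preimage TorusSU2.definable_mulGraph (by fun_prop)).and
      (((RDefinable.eq (by fun_prop) (by fun_prop)).and (RDefinable.forall_fin fun i =>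
        RDefinable.eq (by fun_prop) (by fun_prop))).and
      ((RDefinable.preimage TorusSU2.definable_chart_source (by fun_prop)).and
      ((hc.definable_graph (by fun_prop) (by fun_prop)).and
      ((RDefinable.eq (by fun_prop) (by fun_prop)).and
      ((RDefinable.eq (by fun_prop) (by fun_prop)).and
      ((RDefinable.eq (by fun_prop) (by fun_prop)).and
      (RDefinable.eq (by fun_prop) (by fun_prop)))))))))
  unfold DefinableFunOn
  convert h using 1
  ext v
  constructor
  · rintro ⟨x, hx, rfl⟩
    obtain ⟨p, hp, rfl⟩ := GEx.mem_chartAt_source.1 hx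
    refine ⟨_, ⟨g⁻¹, p, rfl⟩, ⟨rfl, fun i => rfl⟩, ⟨p, hp, rfl⟩, ⟨g⁻¹ * p, rfl, rfl⟩, ?_⟩
    rw [GEx.chartAt_mk hp]
    exact (TorusSU2.chart_eq_iff hp).1 rfl
  · rintro ⟨_, ⟨p, q, rfl⟩, ⟨h1, h2⟩, ⟨q', hq, hq'⟩, ⟨r, hr, hr'⟩, hz⟩
    obtain rfl := TorusSU2.coord_injective hq'
    obtain rfl := TorusSU2.coord_injective hr
    obtain rfl : p = g⁻¹ := by
      refine Prod.ext (Torus.coord_injective ?_) (SU2.coord_injective ?_)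
      · funext i
        rw [Subsingleton.elim i 0]
        exact h1
      · funext i
        exact h2 i
    refine ⟨_, GEx.mem_chartAt_source.2 ⟨q', hq, rfl⟩, ?_⟩
    rw [GEx.chartAt_mk hq, ← hr', ← (TorusSU2.chart_eq_iff hq (z := fun i => v (Sum.inr i))).2 hz]
    exact (Sum.elim_comp_inl_inr v).symm

theorem IsDefinableQuotient.isDefinableManifold {n : ℕ} {c : GEx → Fin n → ℝ}
    (hc : IsDefinableQuotient c) : IsDefinableManifold c := by
  obtain ⟨m, g, hg⟩ := GEx.exists_finite_chartAt_cover
  refine ⟨4, m, fun i => GEx.chartAt (g i), hg, fun i => ⟨?_, hc.definable_chartAt (g i)⟩⟩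
  have h : RDefinable {w : Fin n → ℝ | ∃ z : Fin 4 → ℝ, Sum.elim w z ∈
      {v : Fin n ⊕ Fin 4 → ℝ | ∃ x ∈ (GEx.chartAt (g i)).source,
        v = Sum.elim (c x) (id (GEx.chartAt (g i) x))}} :=
    RDefinable.exists (RDefinable.sumElim_mem (hc.definable_chartAt (g i))
      (by fun_prop) (by fun_prop))
  unfold DefinableSetIn
  convert h using 1
  ext w
  constructor
  · rintro ⟨x, hx, rfl⟩
    exact ⟨_, x, hx, rfl⟩
  · rintro ⟨z, x, hx, e⟩
    exact ⟨x, hx, (Sum.elim_eq_elim_iff.1 e).1.symm⟩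

theorem IsDefinableQuotient.isDefinablyCompactGroup {n : ℕ} {c : GEx → Fin n → ℝ}
    (hc : IsDefinableQuotient c) : IsDefinablyCompactGroup c where
  definableGroup := hc.isDefinableGroup
  topologicalGroup := inferInstance
  manifold := hc.isDefinableManifold
  compact := hc.isDefinablyCompact

end

/-! ### Explicit coordinates presenting G as a definable quotient -/

open scoped commutatorElement

theorem Torus.coord_half : Torus.coord Torus.half 0 = 1 / 2 := by
  rw [Torus.half_eq, Torus.coord_of ⟨by norm_num, by norm_num⟩]

theorem Torus.half_ne_one : Torus.half ≠ 1 := fun h => by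
  have := Torus.coord_eq_zero_iff.2 h
  rw [Torus.coord_half] at this
  norm_num at this

theorem Torus.coord_mul_half {t : Torus} :
    (Torus.coord t 0 < 1 / 2 → Torus.coord (t * Torus.half) 0 = Torus.coord t 0 + 1 / 2) ∧
    (1 / 2 ≤ Torus.coord t 0 → Torus.coord (t * Torus.half) 0 = Torus.coord t 0 - 1 / 2) := by
  have h1 := Torus.coord_mul t Torus.half
  have h2 := Torus.coord_mem (t * Torus.half)
  rw [Torus.coord_half] at h1
  constructor <;> intro h <;> rcases h1 with h1 | h1 <;> linarith [h2.1, h2.2]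

/-- The nontrivial element of Γ shifts the T-coordinate by 1/2, so `[0,1/2)` is a fundamental
domain. -/
theorem GEx.exists_rep (x : GEx) :
    ∃ p : Torus × SU2, Torus.coord p.1 0 < 1 / 2 ∧ QuotientGroup.mk p = x := by
  obtain ⟨p, rfl⟩ := QuotientGroup.mk_surjective x
  rcases lt_or_ge (Torus.coord p.1 0) (1 / 2) with h | h
  · exact ⟨p, h, rfl⟩
  · refine ⟨(p.1 * Torus.half, -p.2), ?_, (GEx.mk_eq_mk_iff.2 (Or.inr rfl)).symm⟩
    rw [Torus.coord_mul_half.2 h]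
    linarith [(Torus.coord_mem p.1).2]

/-- The representative with `T`-coordinate in `[0, 1/2)`. -/
noncomputable def GEx.rep (x : GEx) : Torus × SU2 := (GEx.exists_rep x).choose

theorem GEx.coord_rep_lt (x : GEx) : Torus.coord (GEx.rep x).1 0 < 1 / 2 :=
  (GEx.exists_rep x).choose_spec.1

theorem GEx.mk_rep (x : GEx) : QuotientGroup.mk (GEx.rep x) = x :=
  (GEx.exists_rep x).choose_spec.2

theorem GEx.rep_mk {p : Torus × SU2} (hp : Torus.coord p.1 0 < 1 / 2) :
    GEx.rep (QuotientGroup.mk p) = p := by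
  have h := GEx.coord_rep_lt (QuotientGroup.mk p)
  rcases GEx.mk_eq_mk_iff.1 (GEx.mk_rep (QuotientGroup.mk p)).symm with e | e
  · exact e
  · rw [e, Torus.coord_mul_half.1 hp] at h
    linarith [(Torus.coord_mem p.1).1]

/-- Coordinates on `G`. -/
noncomputable def GEx.coord (x : GEx) : Fin (1 + 4) → ℝ := fun i =>
  TorusSU2.coord (GEx.rep x) (finSumFinEquiv.symm i)

theorem GEx.coord_injective : Function.Injective GEx.coord := fun x y h => by
  rw [← GEx.mk_rep x, ← GEx.mk_rep y]
  congr 1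
  refine TorusSU2.coord_injective (funext fun k => ?_)
  simpa [GEx.coord] using congrFun h (finSumFinEquiv k)

theorem GEx.eq_coord_iff {x : GEx} {w : Fin (1 + 4) → ℝ} : w = GEx.coord x ↔
    ∀ k, w (finSumFinEquiv k) = TorusSU2.coord (GEx.rep x) k := by
  constructor
  · rintro rfl k
    simp [GEx.coord]
  · intro h
    funext i
    simpa [GEx.coord] using h (finSumFinEquiv.symm i)

/-- Passing to the representative is the identity on the lower half of T; on the upper half it
subtracts 1/2 and negates the quaternion. -/
theorem GEx.isDefinableQuotient_coord : IsDefinableQuotient GEx.coord := by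
  refine ⟨GEx.coord_injective, ?_⟩
  have h : RDefinable {v : (Fin 1 ⊕ Fin 4) ⊕ Fin (1 + 4) → ℝ |
      (fun k => v (Sum.inl k)) ∈ range TorusSU2.coord ∧
      ((v (Sum.inl (Sum.inl 0)) < 1 / 2 ∧
        v (Sum.inr (finSumFinEquiv (Sum.inl 0))) = v (Sum.inl (Sum.inl 0)) ∧
        ∀ i : Fin 4, v (Sum.inr (finSumFinEquiv (Sum.inr i))) = v (Sum.inl (Sum.inr i))) ∨
      (1 / 2 ≤ v (Sum.inl (Sum.inl 0)) ∧
        v (Sum.inr (finSumFinEquiv (Sum.inl 0))) = v (Sum.inl (Sum.inl 0)) - 1 / 2 ∧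
        ∀ i : Fin 4, v (Sum.inr (finSumFinEquiv (Sum.inr i))) = -v (Sum.inl (Sum.inr i))))} :=
    (RDefinable.mem_range_coord (by fun_prop)).and
      (((RDefinable.lt (by fun_prop) (by fun_prop)).and
        ((RDefinable.eq (by fun_prop) (by fun_prop)).and
        (RDefinable.forall_fin fun i => RDefinable.eq (by fun_prop) (by fun_prop)))).or
      ((RDefinable.le (by fun_prop) (by fun_prop)).and
        ((RDefinable.eq (by fun_prop) (by fun_prop)).and
        (RDefinable.forall_fin fun i => RDefinable.eq (by fun_prop) (by fun_prop)))))
  unfold DefinableFunOn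
  convert h using 1
  ext v
  have key : ∀ (p : Torus × SU2) (w : Fin (1 + 4) → ℝ), w = GEx.coord (QuotientGroup.mk p) ↔
      ((Torus.coord p.1 0 < 1 / 2 ∧ w (finSumFinEquiv (Sum.inl 0)) = Torus.coord p.1 0 ∧
        ∀ i : Fin 4, w (finSumFinEquiv (Sum.inr i)) = SU2.coord p.2 i) ∨
      (1 / 2 ≤ Torus.coord p.1 0 ∧ w (finSumFinEquiv (Sum.inl 0)) = Torus.coord p.1 0 - 1 / 2 ∧
        ∀ i : Fin 4, w (finSumFinEquiv (Sum.inr i)) = -SU2.coord p.2 i)) := by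
    intro p w
    rw [GEx.eq_coord_iff, Sum.forall, Fin.forall_fin_one]
    rcases lt_or_ge (Torus.coord p.1 0) (1 / 2) with hp | hp
    · rw [GEx.rep_mk hp]
      simp only [hp, not_le.2 hp, true_and, false_and, or_false]
      rfl
    · have e : (QuotientGroup.mk p : GEx) = QuotientGroup.mk (p.1 * Torus.half, -p.2) :=
        GEx.mk_eq_mk_iff.2 (Or.inr rfl)
      have hlt : Torus.coord (p.1 * Torus.half) 0 < 1 / 2 := by
        rw [Torus.coord_mul_half.2 hp]
        linarith [(Torus.coord_mem p.1).2]
      rw [e, GEx.rep_mk (p := (p.1 * Torus.half, -p.2)) hlt]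
      simp only [hp, not_lt.2 hp, true_and, false_and, false_or]
      rw [← Torus.coord_mul_half.2 hp]
      have hneg : ∀ i, -SU2.coord p.2 i = SU2.coord (-p.2) i := fun i => by
        rw [SU2.coord_neg, Pi.neg_apply]
      simp only [hneg]
      rfl
  constructor
  · rintro ⟨p, -, rfl⟩
    exact ⟨⟨p, rfl⟩, (key p _).1 rfl⟩
  · rintro ⟨⟨p, hp⟩, h2⟩
    have h3 : ∀ k, v (Sum.inl k) = TorusSU2.coord p k := fun k => (congrFun hp k).symm
    simp only [h3] at h2
    refine ⟨p, mem_univ _, ?_⟩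
    rw [hp, ← (key p fun i => v (Sum.inr i)).2 h2]
    exact (Sum.elim_comp_inl_inr v).symm

/-! ### The derived subgroup and its closed complement -/

theorem SU2.exists_orthogonal (q : SU2) : ∃ v : SU2, (v : Quaternion ℝ).re = 0 ∧
    (q : Quaternion ℝ).imI * (v : Quaternion ℝ).imI +
      (q : Quaternion ℝ).imJ * (v : Quaternion ℝ).imJ +
      (q : Quaternion ℝ).imK * (v : Quaternion ℝ).imK = 0 := by
  by_cases h : (q : Quaternion ℝ).imI = 0 ∧ (q : Quaternion ℝ).imJ = 0
  · exact ⟨SU2.mk ![0, 1, 0, 0] (by simp), rfl, by simp [SU2.mk, h]⟩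
  · have h0 : 0 < (q : Quaternion ℝ).imI ^ 2 + (q : Quaternion ℝ).imJ ^ 2 := by
      rw [not_and_or] at h
      rcases h with h | h
      · have := sq_pos_of_ne_zero h
        positivity
      · have := sq_pos_of_ne_zero h
        positivity
    have h1 := (Real.sqrt_pos.2 h0).ne'
    have h2 := Real.sq_sqrt h0.le
    refine ⟨SU2.mk ![0, -(q : Quaternion ℝ).imJ / √((q : Quaternion ℝ).imI ^ 2 +
      (q : Quaternion ℝ).imJ ^ 2), (q : Quaternion ℝ).imI / √((q : Quaternion ℝ).imI ^ 2 +
      (q : Quaternion ℝ).imJ ^ 2), 0] ?_, rfl, ?_⟩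
    · simp only [Matrix.cons_val]
      field_simp
      linarith
    · simp only [SU2.mk, Matrix.cons_val]
      ring

/-- A purely imaginary `v` orthogonal to the imaginary part of `q` satisfies v q = q̄ v, whence q v
q = q q̄ v = v. -/
theorem SU2.mul_mul_self_of_orthogonal {q v : Quaternion ℝ} (hq : q ∈ unitary (Quaternion ℝ))
    (hv : v.re = 0) (h : q.imI * v.imI + q.imJ * v.imJ + q.imK * v.imK = 0) :
    q * v * q = v := by
  have h1 := (SU2.mem_iff q).1 hq
  refine Quaternion.ext _ _ ?_ ?_ ?_ ?_
  · simp only [Quaternion.re_mul, Quaternion.imI_mul, Quaternion.imJ_mul, Quaternion.imK_mul, hv]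
    linear_combination (-2 * q.re) * h
  · simp only [Quaternion.re_mul, Quaternion.imI_mul, Quaternion.imJ_mul, Quaternion.imK_mul, hv]
    linear_combination (-2 * q.imI) * h + v.imI * h1
  · simp only [Quaternion.re_mul, Quaternion.imI_mul, Quaternion.imJ_mul, Quaternion.imK_mul, hv]
    linear_combination (-2 * q.imJ) * h + v.imJ * h1
  · simp only [Quaternion.re_mul, Quaternion.imI_mul, Quaternion.imJ_mul, Quaternion.imK_mul, hv]
    linear_combination (-2 * q.imK) * h + v.imK * h1

/-- The equation to solve is a b = q b a. For q ≠ -1 take b = v as in the previous lemma and a the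
normalisation of 1 + q: both (1 + q) v and q v (1 + q) equal v + q v. -/
theorem SU2.exists_commutator (q : SU2) : ∃ a b : SU2, ⁅a, b⁆ = q := by
  have key : ∀ a b : SU2, a * b = q * b * a → ⁅a, b⁆ = q := fun a b h => by
    rw [commutatorElement_def, mul_inv_eq_iff_eq_mul, mul_inv_eq_iff_eq_mul, h]
  have hq := (SU2.mem_iff q).1 q.2
  by_cases h : (q : Quaternion ℝ).re = -1
  · rw [h] at hq
    have e1 : (q : Quaternion ℝ).imI = 0 := by
      nlinarith [sq_nonneg ((q : Quaternion ℝ).imI),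
        sq_nonneg ((q : Quaternion ℝ).imJ), sq_nonneg ((q : Quaternion ℝ).imK)]
    have e2 : (q : Quaternion ℝ).imJ = 0 := by
      nlinarith [sq_nonneg ((q : Quaternion ℝ).imI),
        sq_nonneg ((q : Quaternion ℝ).imJ), sq_nonneg ((q : Quaternion ℝ).imK)]
    have e3 : (q : Quaternion ℝ).imK = 0 := by
      nlinarith [sq_nonneg ((q : Quaternion ℝ).imI),
        sq_nonneg ((q : Quaternion ℝ).imJ), sq_nonneg ((q : Quaternion ℝ).imK)]
    -- For q = -1, where 1 + q vanishes, i and j anticommute.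
    refine ⟨SU2.mk ![0, 1, 0, 0] (by simp), SU2.mk ![0, 0, 1, 0] (by simp), key _ _ ?_⟩
    have hq1 : q = -1 := by
      refine SU2.coord_injective ?_
      rw [SU2.coord_neg, SU2.coord_one]
      funext i
      fin_cases i <;> simp [SU2.coord, h, e1, e2, e3]
    refine SU2.coord_injective ?_
    rw [hq1, neg_one_mul, neg_mul, SU2.coord_neg, SU2.coord_mul, SU2.coord_mul, SU2.coord_mk,
      SU2.coord_mk]
    funext i
    fin_cases i <;> simp [quatMul]
  · obtain ⟨v, hv, hqv⟩ := SU2.exists_orthogonal q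
    have hvq := SU2.mul_mul_self_of_orthogonal q.2 hv hqv
    have hlt : 0 < 2 + 2 * (q : Quaternion ℝ).re := by
      have h1 : -1 ≤ (q : Quaternion ℝ).re := by
        nlinarith [sq_nonneg ((q : Quaternion ℝ).imI),
          sq_nonneg ((q : Quaternion ℝ).imJ), sq_nonneg ((q : Quaternion ℝ).imK)]
      have := lt_of_le_of_ne h1 (Ne.symm h)
      linarith
    -- The squared norm of 1 + q is 2 + 2 re q.
    set s := (√(2 + 2 * (q : Quaternion ℝ).re))⁻¹ with hs
    have hs2 : s ^ 2 * (2 + 2 * (q : Quaternion ℝ).re) = 1 := by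
      rw [hs, inv_pow, Real.sq_sqrt hlt.le, inv_mul_cancel₀ hlt.ne']
    have hp : s • (1 + (q : Quaternion ℝ)) ∈ unitary (Quaternion ℝ) := by
      rw [SU2.mem_iff]
      simp only [Quaternion.re_smul, Quaternion.imI_smul, Quaternion.imJ_smul,
        Quaternion.imK_smul, Quaternion.re_add, Quaternion.imI_add, Quaternion.imJ_add,
        Quaternion.imK_add, Quaternion.re_one, Quaternion.imI_one, Quaternion.imJ_one,
        Quaternion.imK_one, smul_eq_mul]
      linear_combination s ^ 2 * hq + hs2
    refine ⟨⟨_, hp⟩, v, key _ _ (Subtype.ext ?_)⟩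
    change s • (1 + (q : Quaternion ℝ)) * v = q * v * s • (1 + (q : Quaternion ℝ))
    rw [smul_mul_assoc, mul_smul_comm, mul_add, mul_one, hvq, add_mul, one_mul, add_comm]

theorem GEx.mem_commutator_iff {x : GEx} :
    x ∈ commutator GEx ↔ ∃ q : SU2, x = QuotientGroup.mk (1, q) := by
  constructor
  · have h : commutator GEx ≤
        ((QuotientGroup.mk' Gam).comp (MonoidHom.inr Torus SU2)).range := by
      refine Subgroup.commutator_le.2 fun x _ y _ => ?_
      obtain ⟨p, rfl⟩ := QuotientGroup.mk_surjective x
      obtain ⟨q, rfl⟩ := QuotientGroup.mk_surjective y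
      refine ⟨⁅p.2, q.2⁆, ?_⟩
      change QuotientGroup.mk (1, ⁅p.2, q.2⁆) = QuotientGroup.mk ⁅p, q⁆
      congr 1
      refine Prod.ext ?_ rfl
      exact (commutatorElement_eq_one_iff_mul_comm.2 (mul_comm p.1 q.1)).symm
    intro hx
    obtain ⟨q, hq⟩ := h hx
    exact ⟨q, hq.symm⟩
  · rintro ⟨q, rfl⟩
    obtain ⟨a, b, rfl⟩ := SU2.exists_commutator q
    have h := Subgroup.commutator_mem_commutator
      (Subgroup.mem_top (QuotientGroup.mk (1, a) : GEx))
      (Subgroup.mem_top (QuotientGroup.mk (1, b) : GEx))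
    have e : ⁅(QuotientGroup.mk (1, a) : GEx), QuotientGroup.mk (1, b)⁆ =
        QuotientGroup.mk ⁅((1 : Torus), a), ((1 : Torus), b)⁆ :=
      (map_commutatorElement (QuotientGroup.mk' Gam) _ _).symm
    rw [e] at h
    have e2 : ⁅((1 : Torus), a), ((1 : Torus), b)⁆ = (1, ⁅a, b⁆) :=
      Prod.ext (commutatorElement_self (1 : Torus)) rfl
    rwa [e2] at h

/-- The embedding of the unit circle in the unit quaternions. -/
noncomputable def SU2.ofCircle : Circle →* SU2 where
  toFun z := SU2.mk ![(z : ℂ).re, (z : ℂ).im, 0, 0] (by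
    have := Circle.normSq_coe z
    rw [Complex.normSq_apply] at this
    simp only [Matrix.cons_val]
    linarith)
  map_one' := by
    refine SU2.coord_injective ?_
    rw [SU2.coord_mk, SU2.coord_one]
    simp
  map_mul' z w := by
    refine SU2.coord_injective ?_
    rw [SU2.coord_mul, SU2.coord_mk, SU2.coord_mk, SU2.coord_mk]
    funext i
    fin_cases i <;> simp [quatMul]

theorem SU2.coord_ofCircle (z : Circle) :
    SU2.coord (SU2.ofCircle z) = ![(z : ℂ).re, (z : ℂ).im, 0, 0] := by
  funext i
  fin_cases i <;> rfl

theorem SU2.continuous_ofCircle : Continuous SU2.ofCircle := by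
  refine SU2.continuous_of_coord ?_
  simp only [SU2.coord_ofCircle]
  refine continuous_pi fun i => ?_
  fin_cases i
  · exact Complex.continuous_re.comp (by fun_prop)
  · exact Complex.continuous_im.comp (by fun_prop)
  · exact continuous_const
  · exact continuous_const

/-- The homomorphism `t ↦ exp (2 π i t)` from `T` to the unit quaternions. -/
noncomputable def Torus.toSU2 : Torus →* SU2 :=
  SU2.ofCircle.comp
    { toFun := fun t => AddCircle.toCircle (Multiplicative.toAdd t)
      map_one' := AddCircle.toCircle_zero
      map_mul' := fun _ _ => AddCircle.toCircle_add _ _ }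

theorem Torus.continuous_toSU2 : Continuous Torus.toSU2 :=
  SU2.continuous_ofCircle.comp (AddCircle.continuous_toCircle.comp continuous_toAdd)

theorem Torus.toSU2_half : Torus.toSU2 Torus.half = -1 := by
  have h : AddCircle.toCircle (((1 / 2 : ℝ)) : AddCircle (1 : ℝ)) = Circle.exp Real.pi := by
    rw [AddCircle.toCircle_apply_mk]
    congr 1
    ring
  refine SU2.coord_injective ?_
  change SU2.coord (SU2.ofCircle (AddCircle.toCircle (((1 / 2 : ℝ)) : AddCircle (1 : ℝ)))) = _
  rw [h, SU2.coord_neg, SU2.coord_one, SU2.coord_ofCircle]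
  simp

/-- The complement is the image of the graph of t ↦ exp(2πit). It meets G' trivially because the
only ambiguous parameter t = 1/2 gives (1/2, -1), an element of Γ. -/
theorem GEx.exists_closed_complement :
    ∃ H : Subgroup GEx, IsClosed (H : Set GEx) ∧ (commutator GEx).IsComplement' H := by
  let ψ : Torus →* GEx :=
    (QuotientGroup.mk' Gam).comp ((MonoidHom.id Torus).prod Torus.toSU2)
  have hψ : ∀ t, ψ t = QuotientGroup.mk (t, Torus.toSU2 t) := fun t => rfl
  -- Closedness of Γ makes the quotient Hausdorff, so compact subsets are closed.
  have hGam : IsClosed (Gam : Set (Torus × SU2)) :=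
    (Set.toFinite ({(1, 1), (Torus.half, -1)} : Set (Torus × SU2))).isClosed
  refine ⟨ψ.range, ?_, Subgroup.isComplement'_of_disjoint_and_mul_eq_univ ?_ ?_⟩
  · rw [MonoidHom.coe_range]
    refine (isCompact_range ?_).isClosed
    exact QuotientGroup.continuous_mk.comp (continuous_id.prodMk Torus.continuous_toSU2)
  · rw [Subgroup.disjoint_def]
    rintro x hx ⟨t, rfl⟩
    obtain ⟨q, hq⟩ := GEx.mem_commutator_iff.1 hx
    rw [hψ] at hq
    rcases GEx.mk_eq_mk_iff.1 hq.symm with h | h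
    · have h1 : t = 1 := congrArg Prod.fst h
      rw [h1, map_one]
    · have h1 : t = Torus.half := (congrArg Prod.fst h).trans (one_mul _)
      rw [hψ, h1, Torus.toSU2_half]
      refine (GEx.mk_eq_mk_iff (p := 1)).2 (Or.inr ?_) |>.symm
      simp
  · refine eq_univ_of_forall fun x => ?_
    obtain ⟨p, rfl⟩ := QuotientGroup.mk_surjective x
    refine ⟨QuotientGroup.mk (1, p.2 * (Torus.toSU2 p.1)⁻¹), GEx.mem_commutator_iff.2 ⟨_, rfl⟩,
      ψ p.1, ⟨p.1, rfl⟩, ?_⟩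
    change QuotientGroup.mk ((1 : Torus) * p.1, p.2 * (Torus.toSU2 p.1)⁻¹ * Torus.toSU2 p.1) = _
    rw [one_mul, inv_mul_cancel_right]

/-! ### Absence of a definable complement -/

/-- A subgroup complementing the derived subgroup is the graph of a homomorphism `T → SU₂`. -/
theorem GEx.exists_hom_of_isComplement' {H : Subgroup GEx}
    (hH : (commutator GEx).IsComplement' H) : ∃ f : Torus →* SU2,
      (∀ t q, (QuotientGroup.mk (t, q) : GEx) ∈ H ↔ q = f t) ∧ f Torus.half = -1 := by
  -- Decompose the class of `(t, 1)`: its factor in G' is the class of some `(1, a)`, so its factor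
  -- in `H` is the class of `(t, a⁻¹)`.
  have hex : ∀ t : Torus, ∃ q : SU2, (QuotientGroup.mk (t, q) : GEx) ∈ H := by
    intro t
    obtain ⟨⟨⟨g, hg⟩, ⟨h, hh⟩⟩, e⟩ := hH.2 (QuotientGroup.mk (t, 1) : GEx)
    obtain ⟨a, rfl⟩ := GEx.mem_commutator_iff.1 hg
    refine ⟨a⁻¹, ?_⟩
    have e' : (QuotientGroup.mk (1, a) : GEx) * h = QuotientGroup.mk (t, 1) := e
    have e2 : h = QuotientGroup.mk ((1 : Torus)⁻¹ * t, a⁻¹ * 1) := by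
      rw [← inv_mul_eq_iff_eq_mul.2 e'.symm]
      rfl
    rwa [e2, inv_one, one_mul, mul_one] at hh
  -- The quotient of two candidates lies in both `H` and G', and SU₂ embeds in G because `(1/2, -1)`
  -- has nontrivial T-component.
  have huniq : ∀ (t : Torus) (q q' : SU2), (QuotientGroup.mk (t, q) : GEx) ∈ H →
      (QuotientGroup.mk (t, q') : GEx) ∈ H → q = q' := by
    intro t q q' h h'
    have h1 : (QuotientGroup.mk (1, q⁻¹ * q') : GEx) ∈ H := by
      have : (QuotientGroup.mk (t⁻¹ * t, q⁻¹ * q') : GEx) ∈ H := H.mul_mem (H.inv_mem h) h'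
      rwa [inv_mul_cancel] at this
    have h2 := Subgroup.disjoint_def.1 hH.disjoint (GEx.mem_commutator_iff.2 ⟨_, rfl⟩) h1
    rcases GEx.mk_eq_mk_iff.1 (h2 : (QuotientGroup.mk (1, q⁻¹ * q') : GEx) =
        QuotientGroup.mk (1 : Torus × SU2)) with h3 | h3
    · exact inv_mul_eq_one.1 (congrArg Prod.snd h3).symm
    · exact absurd ((congrArg Prod.fst h3).trans (one_mul _)).symm Torus.half_ne_one
  choose f hf using hex
  refine ⟨MonoidHom.mk' f fun s t => huniq _ _ _ (hf _) (H.mul_mem (hf s) (hf t)),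
    fun t q => ⟨fun h => huniq _ _ _ h (hf t), fun h => h ▸ hf t⟩, huniq _ _ _ (hf _) ?_⟩
  have : (QuotientGroup.mk (Torus.half, -1) : GEx) = QuotientGroup.mk 1 :=
    (GEx.mk_eq_mk_iff.2 (Or.inr (by simp))).symm
  rw [this]
  exact H.one_mem

/-- There is no definable homomorphism `T → SU₂` that maps `1/2` to `-1`. -/
theorem Torus.hom_SU2_half_ne (f : Torus →* SU2) (hf : RDefinable
    {v : Fin 1 ⊕ Fin 4 → ℝ | ∃ t, v = Sum.elim (Torus.coord t) (SU2.coord (f t))}) :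
    f Torus.half ≠ -1 := by
  intro hhalf
  -- A square root of -1 in the image of `f`, hence a purely imaginary unit quaternion.
  set u : Fin 4 → ℝ := SU2.coord (f (Torus.of (1 / 4))) with hu
  have huu : quatMul u u = -![1, 0, 0, 0] := by
    rw [← SU2.coord_mul, ← map_mul, ← Torus.of_add, ← SU2.coord_one, ← SU2.coord_neg, ← hhalf,
      Torus.half_eq]
    norm_num
  have hu1 : u 0 ^ 2 + u 1 ^ 2 + u 2 ^ 2 + u 3 ^ 2 = 1 := SU2.coord_sq _
  have hu0 : u 0 = 0 := by
    have h0 := congrFun huu 0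
    simp only [quatMul, Matrix.cons_val_zero, Pi.neg_apply] at h0
    have : u 0 ^ 2 = 0 := by linarith
    exact pow_eq_zero_iff two_ne_zero |>.1 this
  rw [hu0] at hu1
  -- The coefficient of a quaternion along `u`.
  let β : (Fin 4 → ℝ) → ℝ := fun q => u 1 * q 1 + u 2 * q 2 + u 3 * q 3
  -- T is abelian, so `f t` commutes with `u`; the centraliser of `u` is ℝ + ℝu.
  have hβ : ∀ t, SU2.coord (f t) 1 = β (SU2.coord (f t)) * u 1 ∧
      SU2.coord (f t) 2 = β (SU2.coord (f t)) * u 2 ∧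
      SU2.coord (f t) 3 = β (SU2.coord (f t)) * u 3 := by
    intro t
    have hcomm : quatMul u (SU2.coord (f t)) = quatMul (SU2.coord (f t)) u := by
      rw [← SU2.coord_mul, ← SU2.coord_mul, ← map_mul, ← map_mul, mul_comm]
    have h1 := congrFun hcomm 1
    have h2 := congrFun hcomm 2
    have h3 := congrFun hcomm 3
    simp only [quatMul, Matrix.cons_val, hu0] at h1 h2 h3
    simp only [β]
    refine ⟨?_, ?_, ?_⟩
    · linear_combination (-SU2.coord (f t) 1) * hu1 - u 2 * h3 / 2 + u 3 * h2 / 2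
    · linear_combination (-SU2.coord (f t) 2) * hu1 - u 3 * h1 / 2 + u 1 * h3 / 2
    · linear_combination (-SU2.coord (f t) 3) * hu1 - u 1 * h2 / 2 + u 2 * h1 / 2
  have hnorm : ∀ t, SU2.coord (f t) 0 ^ 2 + β (SU2.coord (f t)) ^ 2 = 1 := by
    intro t
    have h := SU2.coord_sq (f t)
    obtain ⟨h1, h2, h3⟩ := hβ t
    rw [h1, h2, h3] at h
    linear_combination h - β (SU2.coord (f t)) ^ 2 * hu1
  let φ : Torus →* Circle := MonoidHom.mk' (fun t => ⟨⟨SU2.coord (f t) 0, β (SU2.coord (f t))⟩, by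
    refine mem_sphere_zero_iff_norm.2 ?_
    rw [← sq_eq_sq₀ (norm_nonneg _) zero_le_one, Complex.sq_norm, Complex.normSq_apply]
    linear_combination hnorm t⟩) (by
    intro s t
    obtain ⟨h1, h2, h3⟩ := hβ s
    obtain ⟨k1, k2, k3⟩ := hβ t
    refine Circle.ext (Complex.ext ?_ ?_)
    · refine Eq.trans ?_ (Complex.mul_re _ _).symm
      change SU2.coord (f (s * t)) 0 = SU2.coord (f s) 0 * SU2.coord (f t) 0 -
        β (SU2.coord (f s)) * β (SU2.coord (f t))
      rw [map_mul, SU2.coord_mul]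
      simp only [quatMul, Matrix.cons_val]
      rw [h1, h2, h3, k1, k2, k3]
      linear_combination (-β (SU2.coord (f s)) * β (SU2.coord (f t))) * hu1
    · refine Eq.trans ?_ (Complex.mul_im _ _).symm
      change β (SU2.coord (f (s * t))) = SU2.coord (f s) 0 * β (SU2.coord (f t)) +
        β (SU2.coord (f s)) * SU2.coord (f t) 0
      rw [map_mul, SU2.coord_mul]
      have e : ∀ a b : Fin 4 → ℝ, β (quatMul a b) = a 0 * β b + β a * b 0 +
          (u 1 * (a 2 * b 3 - a 3 * b 2) + u 2 * (a 3 * b 1 - a 1 * b 3) +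
            u 3 * (a 1 * b 2 - a 2 * b 1)) := by
        intro a b
        simp only [β, quatMul, Matrix.cons_val]
        ring
      rw [e, h1, h2, h3, k1, k2, k3]
      ring)
  have hφ : DefinableFunOn Torus.coord SO2.coord φ Set.univ := by
    have h : RDefinable {v : Fin 1 ⊕ Fin 2 → ℝ | ∃ z : Fin 4 → ℝ,
        Sum.elim (fun i => v (Sum.inl i)) z ∈
          {v : Fin 1 ⊕ Fin 4 → ℝ | ∃ t, v = Sum.elim (Torus.coord t) (SU2.coord (f t))} ∧
        v (Sum.inr 0) = z 0 ∧ v (Sum.inr 1) = u 1 * z 1 + u 2 * z 2 + u 3 * z 3} :=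
      RDefinable.exists ((RDefinable.sumElim_mem hf (by fun_prop) (by fun_prop)).and
        ((RDefinable.eq (by fun_prop) (by fun_prop)).and
          (RDefinable.eq (by fun_prop) (by fun_prop))))
    unfold DefinableFunOn
    convert h using 1
    ext v
    constructor
    · rintro ⟨t, -, rfl⟩
      exact ⟨_, ⟨t, rfl⟩, rfl, rfl⟩
    · rintro ⟨z, ⟨t, ht⟩, h0, h1⟩
      obtain ⟨e1, rfl⟩ := Sum.elim_eq_elim_iff.1 ht
      refine ⟨t, mem_univ _, ?_⟩
      funext k
      rcases k with k | k
      · exact congrFun e1 k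
      · fin_cases k
        · exact h0
        · exact h1
  -- Triviality of `φ` forces real part 1 at 1/2, whereas -1 has real part -1.
  have h1 := congrArg (fun ψ : Torus →* Circle => (ψ Torus.half : ℂ).re)
    (Torus.hom_eq_one_of_definable φ hφ)
  have h2 : SU2.coord (f Torus.half) 0 = 1 := h1
  rw [hhalf, SU2.coord_neg, SU2.coord_one] at h2
  norm_num at h2

/-- The preimage of a definable complement is definable and is exactly the graph of the associated
homomorphism. -/
theorem IsDefinableQuotient.not_exists_definable_complement {n : ℕ} {c : GEx → Fin n → ℝ}
    (hc : IsDefinableQuotient c) : ¬ ∃ H : Subgroup GEx, DefinableSetIn c (H : Set GEx) ∧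
      (commutator GEx).IsComplement' H := by
  rintro ⟨H, hHd, hH⟩
  obtain ⟨f, hf, hhalf⟩ := GEx.exists_hom_of_isComplement' hH
  refine Torus.hom_SU2_half_ne f ?_ hhalf
  have h := hc.preimage hHd
  unfold DefinableSetIn at h
  convert h using 1
  ext v
  constructor
  · rintro ⟨t, rfl⟩
    exact ⟨(t, f t), (hf t _).2 rfl, rfl⟩
  · rintro ⟨⟨t, q⟩, hq, rfl⟩
    exact ⟨t, by rw [← (hf t q).1 hq]; rfl⟩

theorem mainTheorem2 :
    (∃ (n : ℕ) (c : GEx → Fin n → ℝ), IsDefinableQuotient c) ∧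
    (∀ (n : ℕ) (c : GEx → Fin n → ℝ), IsDefinableQuotient c →
      IsDefinablyCompactGroup c ∧
      ¬ ∃ H : Subgroup GEx, DefinableSetIn c (H : Set GEx) ∧ (commutator GEx).IsComplement' H) ∧
    (∃ H : Subgroup GEx, IsClosed (H : Set GEx) ∧ (commutator GEx).IsComplement' H) ∧
    (∀ φ : Torus →* Circle, DefinableFunOn Torus.coord SO2.coord φ Set.univ → φ = 1) :=
  ⟨⟨_, _, GEx.isDefinableQuotient_coord⟩,
    fun _ _ hc => ⟨hc.isDefinablyCompactGroup, hc.not_exists_definable_complement⟩,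
    GEx.exists_closed_complement, Torus.hom_eq_one_of_definable⟩
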